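/- Let $L=\{<,\wedge\}$. A \emph{meet-tree} is a nonempty $L$-structure in which $<$ is a strict partial order, the elements below any given element are pairwise comparable, and $x\wedge y$ is the greatest lower bound of $x$ and $y$. The theory of meet-trees has a model completion, and the following hold for every model completion $T$ of it (that is, for the theory $T$ of \emph{dense meet-trees}). 1. $T$ has small directionality: for every $M\models T$, every $n<\omega$, every complete type $p(x)\in S_n(M)$, every finite set $\Delta$ of partitioned $L$-formulas $\varphi(x,y)$ (with $y$ a finite tuple of variables depending on $\varphi$), and every elementary extension $C$ of $M$ (in particular for a monster model), there are only finitely many complete $\Delta$-types $q(x)$ over $C$ such that $q\cup p$ is finitely satisfiable in $M$. 2. For every $M\models T$, every $n<\omega$ and every complete type $p(x_0,\dots,x_{n-1})\in S_n(M)$, $$\bigcup_{i,j<n}p\upharpoonright(x_i,x_j)\ \cup\ p|_\emptyset\ \vdash\ p$$ modulo the elementary diagram of $M$, where $p\upharpoonright(x_i,x_j)$ is the set of formulas of $p$ in which only $x_i,x_j$ occur as variables, and $p|_\emptyset$ is the set of formulas of $p$ without parameters. 3. There is a number $K<\omega$ such that for every $M\models T$, every $A\subseteq M$ and all complete types $p(x),q(y)\in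 S_1(A)$ in one variable each, at most $K$ complete types $r(x,y)\in S_2(A)$ contain $p(x)\cup q(y)$. -/

import Mathlib

open FirstOrder FirstOrder.Language

universe u v w x

namespace Directionality

/-! ### The language and the universal theory of meet-trees -/

/-- The function symbols of the language of meet-trees: one binary symbol, the meet. -/
inductive TreeFunc : ℕ → Type
  | meet : TreeFunc 2

/-- The relation symbols of the language of meet-trees: one binary symbol, the strict order. -/
inductive TreeRel : ℕ → Type
  | lt : TreeRel 2

/-- The language `{<, ∧}` of meet-trees. -/
def treeLang : FirstOrder.Language.{0, 0} := ⟨TreeFunc, TreeRel⟩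

/-- The symbol `<`. -/
def ltSymb : treeLang.Relations 2 := TreeRel.lt

/-- The symbol `∧`. -/
def meetSymb : treeLang.Functions 2 := TreeFunc.meet

/-- The term `s ∧ t`. -/
def meetT {α : Type u} (s t : treeLang.Term α) : treeLang.Term α := meetSymb.apply₂ s t

/-- The formula `s < t`. -/
def ltF {α : Type u} {n : ℕ} (s t : treeLang.Term (α ⊕ Fin n)) : treeLang.BoundedFormula α n :=
  ltSymb.boundedFormula₂ s t

/-- The formula `s ≤ t`, that is, `s < t` or `s = t`. -/
def leF {α : Type u} {n : ℕ} (s t : treeLang.Term (α ⊕ Fin n)) : treeLang.BoundedFormula α n :=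
  ltF s t ⊔ (s =' t)

/-- The universal theory of meet-trees: `<` is a strict partial order in which the elements below
any given element are pairwise comparable, and `x ∧ y` is the greatest lower bound of `x`, `y`. -/
def meetTree : treeLang.Theory :=
  { -- irreflexivity
    ∀' ∼(ltF &0 &0),
    -- transitivity
    ∀' ∀' ∀' (ltF &0 &1 ⟹ ltF &1 &2 ⟹ ltF &0 &2),
    -- comparability below an element
    ∀' ∀' ∀' (ltF &1 &0 ⟹ ltF &2 &0 ⟹ (leF &1 &2 ⊔ ltF &2 &1)),
    -- the meet is a lower bound
    ∀' ∀' leF (meetT &0 &1) &0,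
    ∀' ∀' leF (meetT &0 &1) &1,
    -- the meet is the greatest lower bound
    ∀' ∀' ∀' (leF &2 &0 ⟹ leF &2 &1 ⟹ leF &2 (meetT &0 &1)) }

section Semantics

variable {M : Type u} [treeLang.Structure M]

/-- The interpretation of `<` in a structure. -/
def Lt (a b : M) : Prop := Structure.RelMap ltSymb ![a, b]

/-- The interpretation of `≤` in a structure. -/
def Le (a b : M) : Prop := Lt a b ∨ a = b

/-- The interpretation of `∧` in a structure. -/
def meet (a b : M) : M := Structure.funMap meetSymb ![a, b]

/-- What the sentences in `meetTree` say in a structure. -/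
theorem model_meetTree_iff : M ⊨ meetTree ↔
    (∀ a : M, ¬ Lt a a) ∧
    (∀ a b c : M, Lt a b → Lt b c → Lt a c) ∧
    (∀ a b c : M, Lt b a → Lt c a → Le b c ∨ Lt c b) ∧
    (∀ a b : M, Le (meet a b) a) ∧
    (∀ a b : M, Le (meet a b) b) ∧
    (∀ a b c : M, Le c a → Le c b → Le c (meet a b)) := by
  simp only [meetTree, Theory.model_iff, Set.mem_insert_iff, Set.mem_singleton_iff,
    forall_eq_or_imp, forall_eq]
  simp [Sentence.Realize, Formula.Realize, ltF, leF, meetT, Lt, Le, meet, Fin.snoc,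
    BoundedFormula.realize_rel₂, Term.realize_functions_apply₂]

end Semantics

/-! ### Model completions -/

/-- `T'` is a model completion of `T`: it contains `T` (up to consequence), every model of `T`
embeds in a model of `T'`, and for every model `K` of `T` the theory `T'` together with the
diagram of `K` is complete, i.e. any two models of `T'` in which `K` is embedded satisfy the same
first-order formulas with parameters from `K`. As usual, structures are nonempty. -/
structure IsModelCompletion {L : FirstOrder.Language.{v, w}} (T' T : L.Theory) : Prop where
  extends_theory : ∀ φ ∈ T, T' ⊨ᵇ φ
  embeds : ∀ (K : Type u) [L.Structure K] [Nonempty K] [K ⊨ T],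
    ∃ (N : Type u) (_ : L.Structure N), N ⊨ T' ∧ Nonempty (K ↪[L] N)
  complete : ∀ (K N₁ N₂ : Type u) [L.Structure K] [L.Structure N₁] [L.Structure N₂]
    [Nonempty K] [K ⊨ T] [N₁ ⊨ T'] [N₂ ⊨ T'] (f₁ : K ↪[L] N₁) (f₂ : K ↪[L] N₂)
    (φ : L.Formula K), φ.Realize (f₁ : K → N₁) ↔ φ.Realize (f₂ : K → N₂)

/-! ### Types over sets of parameters -/

section Types

variable {L : FirstOrder.Language.{v, w}} {C : Type u} [L.Structure C]

/-- `S(A)`: the complete types over a set `A` of parameters from the structure `C`, in variables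
indexed by `α`. -/
abbrev TypeOver (L : FirstOrder.Language.{v, w}) {C : Type u} [L.Structure C] (A : Set C) (α : Type x) :
    Type (max u v w x) :=
  (L[[A]].completeTheory C).CompleteType α

variable {A : Set C} {α : Type x}

/-- The formulas over `A` that belong to a type over `A`. -/
def formulas (p : TypeOver L A α) : Set (L[[A]].Formula α) :=
  {φ | Formula.equivSentence φ ∈ p}

/-- For a tuple `y` of variables of `p`, the restriction `p ↾ y`: all the formulas in `p` in which
only the variables `y` occur. -/
def restrictVars (p : TypeOver L A α) {β : Type} (y : β → α) : Set (L[[A]].Formula α) :=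
  {φ | φ ∈ formulas p ∧ ∃ ψ : L[[A]].Formula β, φ = ψ.relabel y}

/-- The restriction of `p` to the empty set of parameters: all the formulas in `p` without
parameters. -/
def restrictEmpty (p : TypeOver L A α) : Set (L[[A]].Formula α) :=
  {φ | φ ∈ formulas p ∧ ∃ ψ : L.Formula α, φ = (L.lhomWithConstants A).onFormula ψ}

/-- `Γ ⊢ φ` for formulas over `A`, modulo the theory of `C` with constants for `A`: the variables
are treated as new constants. -/
def Entails (Γ : Set (L[[A]].Formula α)) (φ : L[[A]].Formula α) : Prop :=
  (L[[A]].lhomWithConstants α).onTheory (L[[A]].completeTheory C) ∪ Formula.equivSentence '' Γ ⊨ᵇ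
    Formula.equivSentence φ

/-- The complete types `r(x, y)` over `A` that contain both `p(x)` and `q(y)`. -/
def jointTypes (p q : TypeOver L A (Fin 1)) : Set (TypeOver L A (Fin 2)) :=
  {r | (∀ φ ∈ formulas p, φ.relabel ![(0 : Fin 2)] ∈ formulas r) ∧
    (∀ φ ∈ formulas q, φ.relabel ![(1 : Fin 2)] ∈ formulas r)}

end Types

/-! ### Co-heirs and small directionality -/

section Coheirs

variable {L : FirstOrder.Language.{v, w}} {C : Type u} [L.Structure C] {n : ℕ}

/-- The formula `φ(x, c)` with parameters `c` from `C`, for a partitioned formula `φ(x, y)`. -/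
noncomputable def inst {m : ℕ} (φ : L.Formula (Fin n ⊕ Fin m)) (c : Fin m → C) :
    L[[C]].Formula (Fin n) :=
  BoundedFormula.constantsVarsEquiv.symm
    (Formula.relabel (Sum.elim Sum.inr (fun i => Sum.inl (c i))) φ)

theorem realize_inst {m : ℕ} (φ : L.Formula (Fin n ⊕ Fin m)) (c : Fin m → C) (a : Fin n → C) :
    (inst φ c).Realize a ↔ φ.Realize (Sum.elim a c) := by
  rw [Formula.Realize, ← BoundedFormula.realize_constantsVarsEquiv, inst, Equiv.apply_symm_apply]
  refine Formula.realize_relabel.trans (iff_of_eq (congrArg _ ?_))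
  funext i
  rcases i with i | i
  · rfl
  · rfl

/-- A set of partitioned formulas `φ(x, y)`, where `x` is a fixed `n`-tuple of variables and
`y` is a finite tuple whose length depends on `φ`. -/
abbrev PartitionedFormulas (L : FirstOrder.Language.{v, w}) (n : ℕ) : Type (max v w) :=
  Set (Σ m : ℕ, L.Formula (Fin n ⊕ Fin m))

/-- `L_Δ(C)`: the formulas `φ(x, c)` and `¬ φ(x, c)` for `φ(x, y)` in `Δ` and `c` from `C`. -/
def deltaFormulas (Δ : PartitionedFormulas L n) : Set (L[[C]].Formula (Fin n)) :=
  {θ | ∃ φ ∈ Δ, ∃ c : Fin φ.1 → C, θ = inst φ.2 c ∨ θ = ∼(inst φ.2 c)}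

/-- `S_Δ(C)`: the complete `L_Δ(C)`-types, i.e. the finitely satisfiable sets of formulas in
`L_Δ(C)` that contain `φ(x, c)` or `¬ φ(x, c)` for all `φ(x, y)` in `Δ` and all `c` from `C`. -/
def deltaTypes (C : Type u) [L.Structure C] (Δ : PartitionedFormulas L n) :
    Set (Set (L[[C]].Formula (Fin n))) :=
  {q | q ⊆ deltaFormulas Δ ∧
    (∀ q₀ ⊆ q, q₀.Finite → ∃ a : Fin n → C, ∀ θ ∈ q₀, θ.Realize a) ∧
    (∀ φ ∈ Δ, ∀ c : Fin φ.1 → C, inst φ.2 c ∈ q ∨ ∼(inst φ.2 c) ∈ q)}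

/-- `uf_Δ(p)`, computed in `C`: the complete `Δ`-types `q` over `C` such that `q ∪ p` is
finitely satisfiable in `A`. -/
def uf {A : Set C} (Δ : PartitionedFormulas L n) (p : TypeOver L A (Fin n)) :
    Set (Set (L[[C]].Formula (Fin n))) :=
  {q | q ∈ deltaTypes C Δ ∧
    ∀ q₀ ⊆ q, q₀.Finite → ∀ p₀ ⊆ formulas p, p₀.Finite →
      ∃ a : Fin n → C, (∀ i, a i ∈ A) ∧ (∀ θ ∈ q₀, θ.Realize a) ∧ (∀ θ ∈ p₀, θ.Realize a)}

/-- `T` has small directionality: for every model `M` of `T`, every complete finitary type `p` over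
`M` and every finite `Δ`, the set `uf_Δ(p)` is finite. Here `C` runs over all the elementary
extensions of `M`, the monster model being one of them. -/
def SmallDirectionality {L : FirstOrder.Language.{v, w}} (T : L.Theory) : Prop :=
  ∀ (C : Type u) [L.Structure C] [Nonempty C] [C ⊨ T] (M : L.ElementarySubstructure C) (n : ℕ)
    (p : TypeOver L (M : Set C) (Fin n)) (Δ : PartitionedFormulas L n), Δ.Finite →
    (uf Δ p).Finite

end Coheirs

end Directionality

open Directionality

/-! Everything reduces to one ternary relation, `a ∧ b ≤ c`. Meets of pairs from a tuple are closed
under meets, because the meet of `a ∧ b` and `c ∧ d` is the least of `a ∧ b`, `a ∧ c`, `a ∧ d`,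
which form a chain. So the relation determines the generated tree (`isPartialIso_of_tern`).
Back-and-forth between dense trees then gives quantifier elimination (`realize_iff_of_tern`): a type
over parameters is its ternary relation (`eq_of_typeRel`). Embedding any meet-tree into an
ultrapower of an explicit dense tree makes `denseTree` a model completion, and all models of any
other model completion are dense as well.

An atom `a ∧ b ≤ c` with a parameter has at most two variables, and one without parameters belongs
to the type over the empty set. This is the statement on pairs of variables.

If the types of `x` and of `y` over `A` are known, the atoms that mix `x`, `y` and `A` are settled
by five bits (`IsMeetRel.agreeOn_pair`), so there are at most `2 ^ 5` joint types.

For small directionality, extend a coheir to an ultrafilter on `n`-tuples and take the limit of the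
ternary relation. Each coordinate is a point over `C` finitely satisfiable in `M`, and its position
is fixed by its restriction to `M` and three bits (`Position.IsCoheir.eq`). Five bits per pair of
coordinates handle the rest, so only finitely many limits exist. -/

namespace Directionality

/-! ### Trees as meet-semilattices -/

section Trees

/-- The elements below a given element of a meet-semilattice are pairwise comparable. -/
def IsTree (N : Type*) [SemilatticeInf N] : Prop :=
  ∀ a b c : N, b ≤ a → c ≤ a → b ≤ c ∨ c ≤ b

/-- Dense meet-trees: the order is dense and has no least element, and infinitely many open cones
lie above every point. -/
structure IsDenseTree (N : Type*) [SemilatticeInf N] : Prop where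
  tree : IsTree N
  dense : ∀ a b : N, a < b → ∃ c, a < c ∧ c < b
  exists_lt : ∀ a : N, ∃ c, c < a
  exists_cone : ∀ (a : N) (F : Finset N), ∃ c, a < c ∧ ∀ b ∈ F, ¬ a < c ⊓ b

/-- The meets `a ⊓ b` and `a ⊓ c` are comparable below `a`, and the smaller one lies below `b ⊓ c`.
Hence lying in the same open cone above `e` is transitive. -/
theorem IsTree.not_inf_le {N : Type*} [SemilatticeInf N] (hN : IsTree N) {a b c e : N}
    (hab : ¬ a ⊓ b ≤ e) (hac : ¬ a ⊓ c ≤ e) : ¬ b ⊓ c ≤ e := by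
  intro h
  rcases hN a (a ⊓ b) (a ⊓ c) inf_le_left inf_le_left with h' | h'
  · exact hab ((le_inf inf_le_right (h'.trans inf_le_right)).trans h)
  · exact hac ((le_inf (h'.trans inf_le_right) inf_le_right).trans h)

/-! ### Finite partial isomorphisms and their extension. -/

variable {N₁ N₂ : Type*} [SemilatticeInf N₁] [SemilatticeInf N₂]

/-- A relation between two meet-semilattices that is the graph of an isomorphism between
subsemilattices. -/
structure IsPartialIso (S : Set (N₁ × N₂)) : Prop where
  le_iff : ∀ s ∈ S, ∀ t ∈ S, s.1 ≤ t.1 ↔ s.2 ≤ t.2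
  inf_mem : ∀ s ∈ S, ∀ t ∈ S, s ⊓ t ∈ S

theorem isPartialIso_empty : IsPartialIso (∅ : Set (N₁ × N₂)) :=
  ⟨fun _ h => h.elim, fun _ h => h.elim⟩

variable {S : Set (N₁ × N₂)}

theorem IsPartialIso.swap (h : IsPartialIso S) : IsPartialIso (Prod.swap ⁻¹' S) :=
  ⟨fun s hs t ht => (h.le_iff s.swap hs t.swap ht).symm,
    fun s hs t ht => h.inf_mem s.swap hs t.swap ht⟩

theorem IsPartialIso.lt_iff (h : IsPartialIso S) {s t : N₁ × N₂} (hs : s ∈ S) (ht : t ∈ S) :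
    s.1 < t.1 ↔ s.2 < t.2 := by
  rw [lt_iff_le_not_ge, lt_iff_le_not_ge, h.le_iff s hs t ht, h.le_iff t ht s hs]

theorem IsPartialIso.eq_iff (h : IsPartialIso S) {s t : N₁ × N₂} (hs : s ∈ S) (ht : t ∈ S) :
    s.1 = t.1 ↔ s.2 = t.2 := by
  rw [le_antisymm_iff, le_antisymm_iff, h.le_iff s hs t ht, h.le_iff t ht s hs]

theorem IsPartialIso.insert (h : IsPartialIso S) {p : N₁ × N₂}
    (h₁ : ∀ s ∈ S, s.1 ≤ p.1 ↔ s.2 ≤ p.2) (h₂ : ∀ s ∈ S, p.1 ≤ s.1 ↔ p.2 ≤ s.2)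
    (h₃ : ∀ s ∈ S, p ⊓ s ∈ insert p S) : IsPartialIso (insert p S) := by
  constructor
  · rintro s (rfl | hs) t (rfl | ht)
    · simp
    · exact h₂ t ht
    · exact h₁ s hs
    · exact h.le_iff s hs t ht
  · rintro s (rfl | hs) t (rfl | ht)
    · simp
    · exact h₃ t ht
    · rw [inf_comm]; exact h₃ s hs
    · exact Or.inr (h.inf_mem s hs t ht)

/-- Closure under meets gives a least `s₁` in the domain above `m`. The position of `m` is then its
place in the chain below `s₁`, and its meet with `s` is `m` if `m ≤ s` and `s ⊓ s₁` otherwise, so no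
further point is created. -/
theorem IsPartialIso.exists_insert_below (h : IsPartialIso S) (hS : S.Finite) (h₁ : IsTree N₁)
    (h₂ : IsDenseTree N₂) {m : N₁} {s₀ : N₁ × N₂} (hs₀ : s₀ ∈ S) (hm : m ≤ s₀.1) :
    ∃ d, IsPartialIso (Insert.insert (m, d) S) := by
  by_cases hmS : ∃ s ∈ S, s.1 = m
  · obtain ⟨s, hs, rfl⟩ := hmS
    exact ⟨s.2, by rwa [Set.insert_eq_of_mem (show (s.1, s.2) ∈ S from hs)]⟩
  obtain ⟨s₁, ⟨hs₁, hm₁⟩, hmin⟩ : ∃ s₁, (s₁ ∈ S ∧ m ≤ s₁.1) ∧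
      ∀ s ∈ S, m ≤ s.1 → s₁.1 ≤ s.1 := by
    obtain ⟨s₁, hs₁, hmin⟩ := Set.Finite.exists_minimalFor Prod.fst {s ∈ S | m ≤ s.1}
      (hS.subset (Set.sep_subset _ _)) ⟨s₀, hs₀, hm⟩
    refine ⟨s₁, hs₁, fun s hs hms => ?_⟩
    -- Comparing with `s₁ ⊓ s` upgrades minimal to least.
    have := hmin (j := s₁ ⊓ s) ⟨h.inf_mem _ hs₁.1 _ hs, le_inf hs₁.2 hms⟩ inf_le_left
    exact this.trans inf_le_right
  have hlt₁ : m < s₁.1 := hm₁.lt_of_ne fun e => hmS ⟨s₁, hs₁, e.symm⟩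
  -- Density gives `d` above the image of the greatest domain point below `m`; if there is no such
  -- point, the absence of a least element gives `d`.
  obtain ⟨d, hd₁, hd⟩ : ∃ d, d < s₁.2 ∧ ∀ s ∈ S, s.1 < m → s.2 < d := by
    by_cases hne : ∃ s ∈ S, s.1 < m
    · obtain ⟨s₂, ⟨hs₂, hm₂⟩, hmax⟩ := Set.Finite.exists_maximalFor Prod.fst {s ∈ S | s.1 < m}
        (hS.subset (Set.sep_subset _ _)) hne
      obtain ⟨d, hd₂, hd₁⟩ := h₂.dense _ _ ((h.lt_iff hs₂ hs₁).1 (hm₂.trans hlt₁))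
      refine ⟨d, hd₁, fun s hs hsm => lt_of_le_of_lt ?_ hd₂⟩
      rw [← h.le_iff s hs s₂ hs₂]
      rcases h₁ m _ _ hsm.le hm₂.le with h' | h'
      · exact h'
      · exact hmax (j := s) ⟨hs, hsm⟩ h'
    · obtain ⟨d, hd⟩ := h₂.exists_lt s₁.2
      exact ⟨d, hd, fun s hs hsm => (hne ⟨s, hs, hsm⟩).elim⟩
  have hle : ∀ s ∈ S, s.1 ≤ m ↔ s.2 ≤ d := by
    refine fun s hs => ⟨fun hsm => (hd s hs (hsm.lt_of_ne fun e => hmS ⟨s, hs, e⟩)).le,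
      fun hsd => ?_⟩
    have hs1 := (h.lt_iff hs hs₁).2 (hsd.trans_lt hd₁)
    rcases h₁ s₁.1 _ _ hs1.le hm₁ with h' | h'
    · exact h'
    · exact (hs1.not_ge (hmin s hs h')).elim
  have hge : ∀ s ∈ S, m ≤ s.1 ↔ d ≤ s.2 := by
    refine fun s hs => ⟨fun hsm => hd₁.le.trans ((h.le_iff _ hs₁ _ hs).1 (hmin s hs hsm)),
      fun hds => ?_⟩
    rcases h₁ s₁.1 (s ⊓ s₁).1 m inf_le_right hm₁ with h' | h'
    · have hmem := h.inf_mem _ hs _ hs₁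
      exact absurd (hd _ hmem (h'.lt_of_ne fun e => hmS ⟨_, hmem, e⟩))
        (not_lt_of_ge (le_inf hds hd₁.le))
    · exact h'.trans inf_le_left
  refine ⟨d, h.insert hle hge fun s hs => ?_⟩
  by_cases hms : m ≤ s.1
  · left
    exact Prod.ext (inf_eq_left.2 hms) (inf_eq_left.2 ((hge s hs).1 hms))
  · right
    have hmem := h.inf_mem _ hs _ hs₁
    have hsm : (s ⊓ s₁).1 ≤ m := by
      rcases h₁ s₁.1 (s ⊓ s₁).1 m inf_le_right hm₁ with h' | h'
      · exact h'
      · exact (hms (h'.trans inf_le_left)).elim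
    have hsd := (hle _ hmem).1 hsm
    convert hmem using 1
    refine Prod.ext (le_antisymm ?_ ?_) (le_antisymm ?_ ?_)
    · exact le_inf inf_le_right (inf_le_left.trans hm₁)
    · exact le_inf hsm inf_le_left
    · exact le_inf inf_le_right (inf_le_left.trans hd₁.le)
    · exact le_inf hsd inf_le_left

/-- The hypothesis `hc` says that the open cone of `c` above `s₀` contains no domain point. Choosing
`d` in a cone above the image of `s₀` that avoids the range gives `c ⊓ s = s₀ ⊓ s` on both sides, so
no new meets arise. -/
theorem IsPartialIso.exists_insert_above (h : IsPartialIso S) (hS : S.Finite)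
    (h₂ : IsDenseTree N₂) {c : N₁} {s₀ : N₁ × N₂} (hs₀ : s₀ ∈ S) (hlt : s₀.1 < c)
    (hc : ∀ s ∈ S, c ⊓ s.1 ≤ s₀.1) :
    ∃ d, IsPartialIso (Insert.insert (c, d) S) := by
  obtain ⟨d, hlt', hd'⟩ := h₂.exists_cone s₀.2 (hS.image Prod.snd).toFinset
  have hd : ∀ s ∈ S, d ⊓ s.2 ≤ s₀.2 := by
    intro s hs
    rcases h₂.tree d _ _ inf_le_left hlt'.le with h' | h'
    · exact h'
    · by_contra hne
      exact hd' s.2 (by simpa using ⟨s.1, hs⟩) (h'.lt_of_not_ge hne)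
  refine ⟨d, h.insert (fun s hs => ⟨fun h' => ?_, fun h' => ?_⟩)
    (fun s hs => ⟨fun h' => ?_, fun h' => ?_⟩) fun s hs => Or.inr ?_⟩
  · exact ((h.le_iff _ hs _ hs₀).1 ((le_inf h' le_rfl).trans (hc s hs))).trans hlt'.le
  · exact ((h.le_iff _ hs _ hs₀).2 ((le_inf h' le_rfl).trans (hd s hs))).trans hlt.le
  · exact (hlt.not_ge ((le_inf le_rfl h').trans (hc s hs))).elim
  · exact (hlt'.not_ge ((le_inf le_rfl h').trans (hd s hs))).elim
  · convert h.inf_mem _ hs₀ _ hs using 1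
    refine Prod.ext (le_antisymm ?_ ?_) (le_antisymm ?_ ?_)
    · exact le_inf (hc s hs) inf_le_right
    · exact inf_le_inf_right _ hlt.le
    · exact le_inf (hd s hs) inf_le_right
    · exact inf_le_inf_right _ hlt'.le

/-- Finite partial isomorphisms from a tree to a dense tree can be extended to any point. -/
theorem IsPartialIso.exists_extension [Nonempty N₂] (h : IsPartialIso S) (hS : S.Finite)
    (h₁ : IsTree N₁) (h₂ : IsDenseTree N₂) (c : N₁) :
    ∃ (S' : Set (N₁ × N₂)) (d : N₂), IsPartialIso S' ∧ S'.Finite ∧ S ⊆ S' ∧ (c, d) ∈ S' := by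
  rcases S.eq_empty_or_nonempty with rfl | hne
  · obtain ⟨d⟩ := ‹Nonempty N₂›
    exact ⟨_, d, h.insert (p := (c, d)) (by simp) (by simp) (by simp), hS.insert _,
      Set.empty_subset _, Set.mem_insert _ _⟩
  -- The branching point of `c` from the domain is the largest `c ⊓ s`. It is added first; then `c`,
  -- if different, sits in an unoccupied cone above it.
  obtain ⟨s, hs, hmax'⟩ := Set.Finite.exists_maximalFor (fun s => c ⊓ s.1) S hS hne
  have hmax : ∀ t ∈ S, c ⊓ t.1 ≤ c ⊓ s.1 := fun t ht => by
    rcases h₁ c (c ⊓ t.1) (c ⊓ s.1) inf_le_left inf_le_left with h' | h'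
    · exact h'
    · exact hmax' ht h'
  obtain ⟨d₁, hd₁⟩ := h.exists_insert_below hS h₁ h₂ hs (inf_le_right : c ⊓ s.1 ≤ s.1)
  rcases (inf_le_left : c ⊓ s.1 ≤ c).eq_or_lt with e | hlt
  · refine ⟨_, d₁, hd₁, hS.insert _, Set.subset_insert _ _, Or.inl ?_⟩
    rw [e]
  · obtain ⟨d, hd⟩ := hd₁.exists_insert_above (hS.insert _) h₂ (Set.mem_insert _ _) hlt <| by
      rintro t (rfl | ht)
      · exact inf_le_right
      · exact hmax t ht
    exact ⟨_, d, hd, (hS.insert _).insert _,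
      (Set.subset_insert _ _).trans (Set.subset_insert _ _), Set.mem_insert _ _⟩

end Trees

/-! ### The ternary relation `a ∧ b ≤ c` -/

section Ternary

/-- The universal properties of the relation `a ∧ b ≤ c` of a meet-tree. -/
structure IsMeetRel {X : Type*} (R : X → X → X → Prop) : Prop where
  left : ∀ a b, R a b a
  symm : ∀ {a b c}, R a b c → R b a c
  trans : ∀ {a b c d e}, R a b c → R a b d → R c d e → R a b e
  comp : ∀ a b c, R a b c ∨ R a c b

variable {X : Type*} {R R' : X → X → X → Prop}

theorem IsMeetRel.right (h : IsMeetRel R) (a b : X) : R a b b := h.symm (h.left b a)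

theorem IsMeetRel.symm_iff (h : IsMeetRel R) {a b c : X} : R a b c ↔ R b a c :=
  ⟨h.symm, h.symm⟩

/-- Among the meets `a ∧ b`, `a ∧ c` and `a ∧ d` there is a least one. -/
theorem IsMeetRel.exists_least (h : IsMeetRel R) (a b c d : X) :
    ∃ e, (e = b ∨ e = c ∨ e = d) ∧ R a e b ∧ R a e c ∧ R a e d := by
  obtain ⟨e, he, hb, hc⟩ : ∃ e, (e = b ∨ e = c) ∧ R a e b ∧ R a e c := by
    rcases h.comp a b c with h' | h'
    · exact ⟨b, Or.inl rfl, h.right _ _, h'⟩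
    · exact ⟨c, Or.inr rfl, h', h.right _ _⟩
  rcases h.comp a e d with h' | h'
  · exact ⟨e, he.imp_right Or.inl, hb, hc, h'⟩
  · exact ⟨d, Or.inr (Or.inr rfl), h.trans (h.left _ _) h' hb, h.trans (h.left _ _) h' hc,
      h.right _ _⟩

/-- The relation `a ∧ b ≤ c` between the values of a map into a meet-semilattice. -/
def Tern {N : Type*} [SemilatticeInf N] (e : X → N) (a b c : X) : Prop := e a ⊓ e b ≤ e c

theorem isMeetRel_tern {N : Type*} [SemilatticeInf N] (hN : IsTree N) (e : X → N) :
    IsMeetRel (Tern e) where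
  left _ _ := inf_le_left
  symm h := by rwa [Tern, inf_comm]
  trans h₁ h₂ h₃ := (le_inf h₁ h₂).trans h₃
  comp a b c := by
    rcases hN (e a) (e a ⊓ e b) (e a ⊓ e c) inf_le_left inf_le_left with h | h
    · exact Or.inl (h.trans inf_le_right)
    · exact Or.inr (h.trans inf_le_right)

/-- Two tuples satisfying the same relations `a ∧ b ≤ c` generate isomorphic trees. -/
theorem isPartialIso_of_tern {N₁ N₂ : Type*} [SemilatticeInf N₁] [SemilatticeInf N₂]
    (h₁ : IsTree N₁) {e₁ : X → N₁} {e₂ : X → N₂}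
    (h : ∀ a b c, Tern e₁ a b c ↔ Tern e₂ a b c) :
    IsPartialIso (Set.range fun p : X × X => (e₁ p.1 ⊓ e₁ p.2, e₂ p.1 ⊓ e₂ p.2)) := by
  constructor
  · rintro _ ⟨p, rfl⟩ _ ⟨q, rfl⟩
    simp only [le_inf_iff]
    exact and_congr (h _ _ _) (h _ _ _)
  · rintro _ ⟨⟨a, b⟩, rfl⟩ _ ⟨⟨c, d⟩, rfl⟩
    -- With `a ⊓ x` the least of `a ⊓ b`, `a ⊓ c`, `a ⊓ d`, the fourfold meet equals `a ⊓ x`. The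
    -- ternary relation expresses this, so the same `x` serves in `N₂`.
    obtain ⟨x, hx, hb, hc, hd⟩ := (isMeetRel_tern h₁ e₁).exists_least a b c d
    refine ⟨⟨a, x⟩, Prod.ext ?_ ?_⟩
    · refine le_antisymm (le_inf (le_inf inf_le_left hb) (le_inf hc hd)) ?_
      rcases hx with rfl | rfl | rfl
      · exact inf_le_left
      · exact inf_le_inf inf_le_left inf_le_left
      · exact inf_le_inf inf_le_left inf_le_right
    · rw [h] at hb hc hd
      refine le_antisymm (le_inf (le_inf inf_le_left hb) (le_inf hc hd)) ?_
      rcases hx with rfl | rfl | rfl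
      · exact inf_le_left
      · exact inf_le_inf inf_le_left inf_le_left
      · exact inf_le_inf inf_le_left inf_le_right

/-- Two ternary relations agree on a set. -/
def AgreeOn (R R' : X → X → X → Prop) (s : Set X) : Prop :=
  ∀ u ∈ s, ∀ v ∈ s, ∀ w ∈ s, R u v w ↔ R' u v w

theorem AgreeOn.symm {s : Set X} (h : AgreeOn R R' s) : AgreeOn R' R s :=
  fun u hu v hv w hw => (h u hu v hv w hw).symm

theorem AgreeOn.mono {s t : Set X} (h : AgreeOn R R' s) (hts : t ⊆ s) : AgreeOn R R' t :=
  fun u hu v hv w hw => h u (hts hu) v (hts hv) w (hts hw)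

/-- The values of a meet relation on `{x, y} ∪ A` that the values on `{x} ∪ A` and `{y} ∪ A`
leave open. -/
def pairInvariant (R : X → X → X → Prop) (A : Set X) (x y : X) : Fin 5 → Prop :=
  ![∀ a ∈ A, R x a y, ∀ a ∈ A, R y a x, ∃ a ∈ A, R x y a ∧ R x a y, R x x y, R y y x]

/-- If `x ∧ a ≤ y` but some `b` in `A` has `x ∧ b ≰ y`, then `x ∧ a` is strictly below `x ∧ b`, so
`x ∧ a = a ∧ b`. The condition thus splits into `x ∧ a ≤ b` and `a ∧ b ≤ y`, which involve only one
of `x`, `y` over `A`. The bit rules out the case where no such `b` exists. -/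
theorem IsMeetRel.of_bounded (h : IsMeetRel R) (h' : IsMeetRel R') {A : Set X} {x y : X}
    (hx : AgreeOn R R' (insert x A)) (hy : AgreeOn R R' (insert y A))
    (hbit : (∀ a ∈ A, R x a y) ↔ ∀ a ∈ A, R' x a y) {a : X} (ha : a ∈ A) (hR : R' x a y) :
    R x a y := by
  by_contra hn
  obtain ⟨b, hb, hnb⟩ : ∃ b ∈ A, ¬ R' x b y := by
    by_contra! hcon
    exact hn (hbit.2 hcon a ha)
  have hba : ¬ R' x b a := fun e => hnb (h'.trans (h'.left _ _) e hR)
  have hab : R' x a b := (h'.comp x a b).resolve_right hba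
  have hbax : R' b a x := (h'.comp b x a).resolve_left fun e => hba (h'.symm e)
  have hbay : R' b a y := h'.trans hbax (h'.right _ _) hR
  have xA : x ∈ insert x A := Set.mem_insert _ _
  have yA : y ∈ insert y A := Set.mem_insert _ _
  have hab' := (hx x xA a (Or.inr ha) b (Or.inr hb)).2 hab
  have hbay' := (hy b (Or.inr hb) a (Or.inr ha) y yA).2 hbay
  exact hn (h.trans hab' (h.right _ _) hbay')

/-- If `x ∧ a ≰ y`, comparability below `x` already gives `x ∧ y ≤ a`. Otherwise `x ∧ y = x ∧ a`,
and the bit provides `b` in `A` with `x ∧ y = x ∧ b` for `R'`; what remains is `x ∧ b ≤ a`, a fact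
about `x` over `A`. -/
theorem IsMeetRel.inf_le_of_inf_le (h : IsMeetRel R) (h' : IsMeetRel R') {A : Set X} {x y : X}
    (hx : AgreeOn R R' (insert x A)) (hxy : ∀ a ∈ A, R x a y ↔ R' x a y)
    (hbit : (∃ a ∈ A, R x y a ∧ R x a y) → ∃ a ∈ A, R' x y a ∧ R' x a y) {a : X} (ha : a ∈ A)
    (hR : R x y a) : R' x y a := by
  by_cases hay : R' x a y
  · obtain ⟨b, hb, hb₁, hb₂⟩ := hbit ⟨a, ha, hR, (hxy a ha).2 hay⟩
    have hba : R x b a := h.trans (h.left _ _) ((hxy b hb).2 hb₂) hR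
    have hba' := (hx x (Set.mem_insert _ _) b (Or.inr hb) a (Or.inr ha)).1 hba
    exact h'.trans (h'.left _ _) hb₁ hba'
  · exact (h'.comp x y a).resolve_right hay

/-- Two meet relations that agree on `{x} ∪ A` and on `{y} ∪ A` and have the same invariants
agree on `{x, y} ∪ A`. -/
theorem IsMeetRel.agreeOn_pair (h : IsMeetRel R) (h' : IsMeetRel R') {A : Set X} {x y : X}
    (hx : AgreeOn R R' (insert x A)) (hy : AgreeOn R R' (insert y A))
    (hbit : pairInvariant R A x y = pairInvariant R' A x y) :
    AgreeOn R R' (insert x (insert y A)) := by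
  have b0 : (∀ a ∈ A, R x a y) ↔ ∀ a ∈ A, R' x a y := iff_of_eq (congrFun hbit 0)
  have b1 : (∀ a ∈ A, R y a x) ↔ ∀ a ∈ A, R' y a x := iff_of_eq (congrFun hbit 1)
  have b2 : (∃ a ∈ A, R x y a ∧ R x a y) ↔ ∃ a ∈ A, R' x y a ∧ R' x a y :=
    iff_of_eq (congrFun hbit 2)
  have b3 : R x x y ↔ R' x x y := iff_of_eq (congrFun hbit 3)
  have b4 : R y y x ↔ R' y y x := iff_of_eq (congrFun hbit 4)
  have xay : ∀ a ∈ A, R x a y ↔ R' x a y := fun a ha =>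
    ⟨h'.of_bounded h hx.symm hy.symm b0.symm ha, h.of_bounded h' hx hy b0 ha⟩
  have yax : ∀ a ∈ A, R y a x ↔ R' y a x := fun a ha =>
    ⟨h'.of_bounded h hy.symm hx.symm b1.symm ha, h.of_bounded h' hy hx b1 ha⟩
  have xya : ∀ a ∈ A, R x y a ↔ R' x y a := fun a ha =>
    ⟨h.inf_le_of_inf_le h' hx xay b2.1 ha,
      h'.inf_le_of_inf_le h hx.symm (fun a ha => (xay a ha).symm) b2.2 ha⟩
  have xA : x ∈ insert x A := Set.mem_insert _ _
  have yA : y ∈ insert y A := Set.mem_insert _ _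
  have L : ∀ a b, R a b a ↔ R' a b a := fun a b => iff_of_true (h.left _ _) (h'.left _ _)
  have Rt : ∀ a b, R a b b ↔ R' a b b := fun a b => iff_of_true (h.right _ _) (h'.right _ _)
  have axy : ∀ a ∈ A, R a x y ↔ R' a x y := fun a ha => by
    rw [h.symm_iff, h'.symm_iff, xay a ha]
  have ayx : ∀ a ∈ A, R a y x ↔ R' a y x := fun a ha => by
    rw [h.symm_iff, h'.symm_iff, yax a ha]
  have yxa : ∀ a ∈ A, R y x a ↔ R' y x a := fun a ha => by
    rw [h.symm_iff, h'.symm_iff, xya a ha]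
  -- Each triple is trivial, is one of the facts above, or omits `y` or `x` and so falls under `hx`
  -- or `hy`.
  rintro u (rfl | rfl | hu) v (rfl | rfl | hv) w (rfl | rfl | hw)
  all_goals first
    | exact L _ _
    | exact Rt _ _
    | exact b3
    | exact b4
    | exact xay _ ‹_›
    | exact yax _ ‹_›
    | exact xya _ ‹_›
    | exact axy _ ‹_›
    | exact ayx _ ‹_›
    | exact yxa _ ‹_›
    | (refine hx _ ?_ _ ?_ _ ?_ <;> first | exact xA | exact Or.inr ‹_›)
    | (refine hy _ ?_ _ ?_ _ ?_ <;> first | exact yA | exact Or.inr ‹_›)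

end Ternary

/-! ### Coheirs of one point -/

section Coheir

/-- The position of a point `x` over a meet-semilattice: `D c` says `c ≤ x`, `E c c'` says
`x ∧ c ≤ c'`, and `G c` says `x ≤ c`. -/
structure Position (C : Type*) where
  D : C → Prop
  E : C → C → Prop
  G : C → Prop

variable {C : Type*}

/-- The position is finitely satisfiable in `M`. -/
def Position.IsCoheir [SemilatticeInf C] (P : Position C) (M : Set C) : Prop :=
  ∀ F : Set C, F.Finite → ∃ m ∈ M, (∀ c ∈ F, P.D c ↔ c ≤ m) ∧
    (∀ c ∈ F, ∀ c' ∈ F, P.E c c' ↔ m ⊓ c ≤ c') ∧ ∀ c ∈ F, P.G c ↔ m ≤ c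

/-- Two positions agree over `M`. -/
structure Position.AgreeOver (P Q : Position C) (M : Set C) : Prop where
  D : ∀ c ∈ M, P.D c ↔ Q.D c
  E : ∀ c ∈ M, ∀ c' ∈ M, P.E c c' ↔ Q.E c c'
  G : ∀ c ∈ M, P.G c ↔ Q.G c

/-- What a position over `M` leaves open for its coheirs. -/
def Position.invariant [SemilatticeInf C] (P : Position C) (M : Set C) : Fin 3 → Prop :=
  ![∃ d, P.D d ∧ ∀ e ∈ M, P.D e → ¬ d ≤ e,
    ∃ e c, (P.D e ∧ ∀ d, P.D d → d ≤ e) ∧ ¬ P.E c e,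
    ∃ c, P.G c ∧ ∀ m ∈ M, P.G m → ¬ m ≤ c]

variable {P Q : Position C} {M : Set C}

theorem Position.AgreeOver.symm (h : P.AgreeOver Q M) : Q.AgreeOver P M :=
  ⟨fun c hc => (h.D c hc).symm, fun c hc c' hc' => (h.E c hc c' hc').symm,
    fun c hc => (h.G c hc).symm⟩

variable [SemilatticeInf C]

theorem Position.IsCoheir.D_mono (hP : P.IsCoheir M) {d e : C} (h : P.D e) (hd : d ≤ e) :
    P.D d := by
  obtain ⟨m, -, hm, -⟩ := hP {d, e} (by simp)
  rw [hm d (by simp)]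
  exact hd.trans ((hm e (by simp)).1 h)

theorem Position.IsCoheir.G_mono (hP : P.IsCoheir M) {d e : C} (h : P.G d) (hd : d ≤ e) :
    P.G e := by
  obtain ⟨m, -, -, -, hm⟩ := hP {d, e} (by simp)
  rw [hm e (by simp)]
  exact ((hm d (by simp)).1 h).trans hd

/-- When some point below `x` escapes every element of `M` below `x`, the lower set of `P` is as
large as its restriction to `M` permits: it contains that of every coheir `Q` with the same
restriction. Two unbounded coheirs therefore have equal lower sets. -/
theorem Position.IsCoheir.D_of_unbounded (hC : IsTree C) (hM : ∀ a ∈ M, ∀ b ∈ M, a ⊓ b ∈ M)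
    (hP : P.IsCoheir M) (hQ : Q.IsCoheir M) (h : P.AgreeOver Q M) {d₁ d₂ : C} (hd₁ : P.D d₁)
    (hunb : ∀ e ∈ M, P.D e → ¬ d₁ ≤ e) (hd₂ : Q.D d₂) : P.D d₂ := by
  by_contra hnd
  obtain ⟨b, hbM, hb, -⟩ := hQ {d₂} (by simp)
  replace hb := (hb d₂ (by simp)).1 hd₂
  obtain ⟨b', hbM', hb', -⟩ := hP {d₁} (by simp)
  replace hb' := (hb' d₁ (by simp)).1 hd₁
  have hbb := hM b hbM b' hbM'
  obtain ⟨m, hmM, hmD, hmE, -⟩ := hP {d₁, b, b', b ⊓ b', d₂} (Set.toFinite _)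
  have hm₁ : d₁ ≤ m := (hmD d₁ (by simp)).1 hd₁
  -- If `b ⊓ b'` is below `x`, the point leaves `b` there and follows `b'` further; this is visible
  -- over `M`, so it holds for `Q` and forces `d₂ ≤ b ⊓ b'`. If not, `m ⊓ b` is an element of `M`
  -- not below `x`, and it bounds `d₂`.
  by_cases hD : P.D (b ⊓ b')
  · have hnle : ¬ m ⊓ b' ≤ b := fun e =>
      hunb _ hbb hD ((le_inf hm₁ hb').trans (le_inf e inf_le_right))
    have hE : ¬ Q.E b' b := by
      rwa [← h.E b' hbM' b hbM, hmE b' (by simp) b (by simp)]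
    obtain ⟨m₂, -, hm₂D, hm₂E, -⟩ := hQ {d₂, b, b'} (Set.toFinite _)
    rw [hm₂E b' (by simp) b (by simp)] at hE
    have hm₂ : d₂ ≤ m₂ := (hm₂D d₂ (by simp)).1 hd₂
    rcases hC m₂ (m₂ ⊓ b) (m₂ ⊓ b') inf_le_left inf_le_left with h' | h'
    · exact hnd (hP.D_mono hD
        (le_inf hb ((le_inf hm₂ hb).trans (h'.trans inf_le_right))))
    · exact hE (h'.trans inf_le_right)
  · have hle : m ⊓ b' ≤ b := by
      rcases hC b' (m ⊓ b') (b ⊓ b') inf_le_right inf_le_right with h' | h'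
      · exact h'.trans inf_le_left
      · exact (hD ((hmD _ (by simp)).2 (h'.trans inf_le_left))).elim
    have hdm : d₁ ≤ m ⊓ b := le_inf hm₁ ((le_inf hm₁ hb').trans hle)
    have hmbM := hM m hmM b hbM
    have hmb : ¬ Q.D (m ⊓ b) := fun e => hunb _ hmbM ((h.D _ hmbM).2 e) hdm
    obtain ⟨m₂, -, hm₂D, -⟩ := hQ {d₂, m ⊓ b} (Set.toFinite _)
    rw [hm₂D _ (by simp)] at hmb
    have hm₂ : d₂ ≤ m₂ := (hm₂D d₂ (by simp)).1 hd₂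
    rw [hmD d₂ (by simp)] at hnd
    rcases hC b (m₂ ⊓ b) (m ⊓ b) inf_le_right inf_le_right with h' | h'
    · exact hnd ((le_inf hm₂ hb).trans (h'.trans inf_le_left))
    · exact hmb (h'.trans inf_le_left)

theorem Position.IsCoheir.D_of_D (hC : IsTree C) (hM : ∀ a ∈ M, ∀ b ∈ M, a ⊓ b ∈ M)
    (hP : P.IsCoheir M) (hQ : Q.IsCoheir M) (h : P.AgreeOver Q M)
    (hbit : (∃ d, Q.D d ∧ ∀ e ∈ M, Q.D e → ¬ d ≤ e) → ∃ d, P.D d ∧ ∀ e ∈ M, P.D e → ¬ d ≤ e)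
    {d : C} (hd : Q.D d) : P.D d := by
  by_cases hu : ∃ d, Q.D d ∧ ∀ e ∈ M, Q.D e → ¬ d ≤ e
  · obtain ⟨d₁, hd₁, hunb⟩ := hbit hu
    exact hP.D_of_unbounded hC hM hQ h hd₁ hunb hd
  · push Not at hu
    obtain ⟨e, he, heD, hde⟩ := hu d hd
    exact hP.D_mono ((h.D e he).2 heD) hde

/-- A disagreement at `c`, `c'` puts `e = c ⊓ c'` below `x`, with `Q` following `c` beyond `e` and
`P` not. A common lower bound not below `e` would exclude this, so `e` is the greatest element of
the lower set; the bit says that `P` too enters an open cone above `e` that meets `C`. -/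
theorem Position.IsCoheir.E_of_E (hC : IsTree C) (hM : ∀ a ∈ M, ∀ b ∈ M, a ⊓ b ∈ M)
    (hP : P.IsCoheir M) (hQ : Q.IsCoheir M) (h : P.AgreeOver Q M) (hD : ∀ d, P.D d ↔ Q.D d)
    (hbit : (∃ e c, (Q.D e ∧ ∀ d, Q.D d → d ≤ e) ∧ ¬ Q.E c e) →
      ∃ e c, (P.D e ∧ ∀ d, P.D d → d ≤ e) ∧ ¬ P.E c e)
    {c c' : C} (hE : P.E c c') : Q.E c c' := by
  by_contra hnE
  set e := c ⊓ c'
  obtain ⟨m₀, -, hm₀D, hm₀E, -⟩ := hQ {c, c', e} (Set.toFinite _)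
  have hn₀ : ¬ m₀ ⊓ c ≤ e := fun h' =>
    hnE ((hm₀E c (by simp) c' (by simp)).2 (h'.trans inf_le_right))
  have hQe : Q.D e := by
    rw [hm₀D e (by simp)]
    rcases hC c (m₀ ⊓ c) e inf_le_right inf_le_left with h' | h'
    · exact (hn₀ h').elim
    · exact h'.trans inf_le_left
  have hPe : P.D e := (hD e).2 hQe
  by_cases hmax : ∀ d, Q.D d → d ≤ e
  · have hnQ : ¬ Q.E c e := by rwa [hm₀E c (by simp) e (by simp)]
    obtain ⟨e', c₁, ⟨he', hmax'⟩, hc₁⟩ := hbit ⟨e, c, ⟨hQe, hmax⟩, hnQ⟩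
    obtain rfl : e' = e := le_antisymm (hmax e' ((hD e').1 he')) (hmax' e hPe)
    obtain ⟨b₁, hb₁M, hb₁D, hb₁E, -⟩ := hP {c₁, e, c, c'} (Set.toFinite _)
    obtain ⟨b₂, hb₂M, hb₂D, hb₂E, -⟩ := hQ {c, e} (Set.toFinite _)
    have h₁ : ¬ b₁ ⊓ c₁ ≤ e := by rwa [← hb₁E c₁ (by simp) e (by simp)]
    have h₂ : ¬ b₂ ⊓ c ≤ e := by rwa [← hb₂E c (by simp) e (by simp)]
    have hb₁e : e ≤ b₁ := (hb₁D e (by simp)).1 hPe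
    have hb₂e : e ≤ b₂ := (hb₂D e (by simp)).1 hQe
    have hb₁c : b₁ ⊓ c ≤ e := le_inf inf_le_right ((hb₁E c (by simp) c' (by simp)).1 hE)
    -- For `e` in `M`, the cone chosen by `P` is named by `b₁` over `M`, so `Q` chooses it too. For
    -- `e` outside `M`, the meet of `b₁` and `b₂` lies in `M`, hence is not `e`, so they share a
    -- cone. Either way `b₁` and `c` share a cone, against `hb₁c`.
    by_cases heM : e ∈ M
    · obtain ⟨m₁, -, -, hm₁E, -⟩ := hP {c₁, b₁, e} (Set.toFinite _)
      have h₃ : ¬ m₁ ⊓ c₁ ≤ e := by rwa [← hm₁E c₁ (by simp) e (by simp)]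
      have h₄ : ¬ P.E b₁ e := by
        rw [hm₁E b₁ (by simp) e (by simp)]
        rw [inf_comm] at h₃ h₁
        exact hC.not_inf_le h₃ h₁
      rw [h.E b₁ hb₁M e heM] at h₄
      obtain ⟨m₂, -, -, hm₂E, -⟩ := hQ {c, b₁, e} (Set.toFinite _)
      rw [hm₂E b₁ (by simp) e (by simp)] at h₄
      rw [hm₂E c (by simp) e (by simp)] at hnQ
      exact hC.not_inf_le h₄ hnQ hb₁c
    · have hbb : ¬ b₂ ⊓ b₁ ≤ e := fun h' =>
        heM (le_antisymm h' (le_inf hb₂e hb₁e) ▸ hM b₂ hb₂M b₁ hb₁M)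
      exact hC.not_inf_le hbb h₂ hb₁c
  · push Not at hmax
    obtain ⟨d, hd, hde⟩ := hmax
    obtain ⟨m₁, -, hm₁D, hm₁E, -⟩ := hP {c, c', d} (Set.toFinite _)
    obtain ⟨m₂, -, hm₂D, hm₂E, -⟩ := hQ {c, c', d} (Set.toFinite _)
    have h₁ : m₁ ⊓ c ≤ c' := (hm₁E c (by simp) c' (by simp)).1 hE
    have h₂ : ¬ m₂ ⊓ c ≤ c' := by rwa [← hm₂E c (by simp) c' (by simp)]
    have hd₁ : d ≤ m₁ := (hm₁D d (by simp)).1 ((hD d).2 hd)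
    have hd₂ : d ≤ m₂ := (hm₂D d (by simp)).1 hd
    rcases hC m₂ d (m₂ ⊓ c) hd₂ inf_le_left with h' | h'
    · have hdc := h'.trans inf_le_right
      exact hde (le_inf hdc ((le_inf hd₁ hdc).trans h₁))
    · exact h₂ ((le_inf (h'.trans hd₁) inf_le_right).trans h₁)

/-- Below `c`, the point and `m` are comparable, and `m` cannot be above the point. -/
theorem Position.IsCoheir.D_of_not_bounded (hC : IsTree C) (hP : P.IsCoheir M) {c : C}
    (hc : P.G c) (hnc : ∀ m ∈ M, P.G m → ¬ m ≤ c) {m : C} (hmM : m ∈ M) (hm : m ≤ c) :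
    P.D m := by
  obtain ⟨m', hm'M, hD, -, hG⟩ := hP {c, m} (Set.toFinite _)
  rw [hD m (by simp)]
  rw [hG c (by simp)] at hc
  rcases hC c m m' hm hc with h' | h'
  · exact h'
  · exact (hnc m hmM ((hG m (by simp)).2 h') hm).elim

theorem Position.IsCoheir.G_of_G (hC : IsTree C) (hP : P.IsCoheir M) (hQ : Q.IsCoheir M)
    (h : P.AgreeOver Q M)
    (hbit : (∃ c, Q.G c ∧ ∀ m ∈ M, Q.G m → ¬ m ≤ c) → ∃ c, P.G c ∧ ∀ m ∈ M, P.G m → ¬ m ≤ c)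
    {c : C} (hc : Q.G c) : P.G c := by
  by_cases hu : ∃ c, Q.G c ∧ ∀ m ∈ M, Q.G m → ¬ m ≤ c
  · obtain ⟨c₁, hc₁, hunb⟩ := hbit hu
    -- This `m` imitates `P` at `c`, so `m ≤ c` suffices. Being below `c₁`, it is below the point of
    -- `P`, hence below that of `Q`, which is below `c`.
    obtain ⟨m, hmM, -, -, hG⟩ := hP {c₁, c} (Set.toFinite _)
    have hmD := hP.D_of_not_bounded hC hc₁ hunb hmM ((hG c₁ (by simp)).1 hc₁)
    obtain ⟨m', -, hD', -, hG'⟩ := hQ {m, c} (Set.toFinite _)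
    rw [hG c (by simp)]
    exact ((hD' m (by simp)).1 ((h.D m hmM).1 hmD)).trans ((hG' c (by simp)).1 hc)
  · push Not at hu
    obtain ⟨e, he, heG, hec⟩ := hu c hc
    exact hP.G_mono ((h.G e he).2 heG) hec

/-- A coheir is determined by its restriction to `M` and its invariant. -/
theorem Position.IsCoheir.eq (hC : IsTree C) (hM : ∀ a ∈ M, ∀ b ∈ M, a ⊓ b ∈ M)
    (hP : P.IsCoheir M) (hQ : Q.IsCoheir M) (h : P.AgreeOver Q M)
    (hbit : P.invariant M = Q.invariant M) :
    (∀ d, P.D d ↔ Q.D d) ∧ (∀ c c', P.E c c' ↔ Q.E c c') ∧ ∀ c, P.G c ↔ Q.G c := by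
  have b0 : (∃ d, P.D d ∧ ∀ e ∈ M, P.D e → ¬ d ≤ e) ↔ ∃ d, Q.D d ∧ ∀ e ∈ M, Q.D e → ¬ d ≤ e :=
    iff_of_eq (congrFun hbit 0)
  have b1 : (∃ e c, (P.D e ∧ ∀ d, P.D d → d ≤ e) ∧ ¬ P.E c e) ↔
      ∃ e c, (Q.D e ∧ ∀ d, Q.D d → d ≤ e) ∧ ¬ Q.E c e := iff_of_eq (congrFun hbit 1)
  have b2 : (∃ c, P.G c ∧ ∀ m ∈ M, P.G m → ¬ m ≤ c) ↔ ∃ c, Q.G c ∧ ∀ m ∈ M, Q.G m → ¬ m ≤ c :=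
    iff_of_eq (congrFun hbit 2)
  have hD : ∀ d, P.D d ↔ Q.D d := fun d =>
    ⟨hQ.D_of_D hC hM hP h.symm b0.1, hP.D_of_D hC hM hQ h b0.2⟩
  exact ⟨hD, fun c c' => ⟨hP.E_of_E hC hM hQ h hD b1.2,
      hQ.E_of_E hC hM hP h.symm (fun d => (hD d).symm) b1.1⟩,
    fun c => ⟨hQ.G_of_G hC hP h.symm b2.1, hP.G_of_G hC hQ h b2.2⟩⟩

end Coheir

/-! ### Meet-trees as structures -/

section TreeStructures

/-- The structure on a meet-semilattice is the one given by its order. -/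
class IsTreeStructure (N : Type*) [SemilatticeInf N] [treeLang.Structure N] : Prop where
  lt_iff : ∀ a b : N, Lt a b ↔ a < b
  meet_eq : ∀ a b : N, meet a b = a ⊓ b

/-- The meet-semilattice given by a model of the theory of meet-trees. -/
abbrev semilatticeInf {N : Type*} [treeLang.Structure N] (h : N ⊨ meetTree) : SemilatticeInf N where
  lt := Lt
  le := Le
  le_refl a := Or.inr rfl
  le_trans := by
    rintro a b c (hab | rfl) (hbc | rfl)
    · exact Or.inl ((model_meetTree_iff.1 h).2.1 _ _ _ hab hbc)
    · exact Or.inl hab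
    · exact Or.inl hbc
    · exact Or.inr rfl
  lt_iff_le_not_ge a b := by
    have h1 := (model_meetTree_iff.1 h).1
    have h2 := (model_meetTree_iff.1 h).2.1
    refine ⟨fun hab => ⟨Or.inl hab, ?_⟩, ?_⟩
    · rintro (hba | rfl)
      · exact h1 _ (h2 _ _ _ hab hba)
      · exact h1 _ hab
    · rintro ⟨hab | rfl, hn⟩
      · exact hab
      · exact (hn (Or.inr rfl)).elim
  le_antisymm := by
    rintro a b (hab | rfl) (hba | h')
    · exact ((model_meetTree_iff.1 h).1 _ ((model_meetTree_iff.1 h).2.1 _ _ _ hab hba)).elim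
    · exact h'.symm
    · rfl
    · rfl
  inf := meet
  inf_le_left := (model_meetTree_iff.1 h).2.2.2.1
  inf_le_right := (model_meetTree_iff.1 h).2.2.2.2.1
  le_inf a b c := (model_meetTree_iff.1 h).2.2.2.2.2 b c a

theorem exists_isTreeStructure {N : Type*} [treeLang.Structure N] (h : N ⊨ meetTree) :
    ∃ _ : SemilatticeInf N, IsTreeStructure N ∧ IsTree N := by
  let _ := semilatticeInf h
  refine ⟨semilatticeInf h, ⟨fun _ _ => Iff.rfl, fun _ _ => rfl⟩, ?_⟩
  rintro a b c (hb | rfl) (hc | rfl)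
  · exact ((model_meetTree_iff.1 h).2.2.1 a b c hb hc).imp_right Or.inl
  · exact Or.inl (Or.inl hb)
  · exact Or.inr (Or.inl hc)
  · exact Or.inl (Or.inr rfl)

variable {N : Type*} [SemilatticeInf N] [treeLang.Structure N] [IsTreeStructure N]

theorem lt_iff {a b : N} : Lt a b ↔ a < b := IsTreeStructure.lt_iff a b

theorem le_iff {a b : N} : Le a b ↔ a ≤ b := by rw [Le, lt_iff, le_iff_lt_or_eq]

theorem meet_eq (a b : N) : meet a b = a ⊓ b := IsTreeStructure.meet_eq a b

theorem relMap_lt (R : treeLang.Relations 2) (xs : Fin 2 → N) :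
    Structure.RelMap R xs ↔ xs 0 < xs 1 := by
  cases R
  rw [← lt_iff, Lt]
  exact iff_of_eq (congrArg _ (by funext i; fin_cases i <;> rfl))

theorem funMap_meet (f : treeLang.Functions 2) (xs : Fin 2 → N) :
    Structure.funMap f xs = xs 0 ⊓ xs 1 := by
  cases f
  rw [← meet_eq, meet]
  exact congrArg _ (by funext i; fin_cases i <;> rfl)

theorem model_meetTree (hN : IsTree N) : N ⊨ meetTree := by
  simp only [model_meetTree_iff, lt_iff, le_iff, meet_eq]
  refine ⟨lt_irrefl, fun _ _ _ => lt_trans, fun a b c hb hc => ?_, fun _ _ => inf_le_left,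
    fun _ _ => inf_le_right, fun _ _ _ => le_inf⟩
  rcases hN a b c hb.le hc.le with h | h
  · exact Or.inl h
  · exact h.eq_or_lt.elim (fun e => Or.inl e.ge) Or.inr

theorem isTree_of_model (h : N ⊨ meetTree) : IsTree N := by
  intro a b c hb hc
  rcases hb.eq_or_lt with rfl | hb
  · exact Or.inr hc
  rcases hc.eq_or_lt with rfl | hc
  · exact Or.inl hb.le
  have := (model_meetTree_iff.1 h).2.2.1 a b c (lt_iff.2 hb) (lt_iff.2 hc)
  rw [le_iff, lt_iff] at this
  exact this.imp_right le_of_lt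

section Realize

variable {α : Type*} {n : ℕ} {v : α → N} {xs : Fin n → N}

@[simp] theorem realize_ltF {s t : treeLang.Term (α ⊕ Fin n)} :
    (ltF s t).Realize v xs ↔ s.realize (Sum.elim v xs) < t.realize (Sum.elim v xs) := by
  simp [ltF, BoundedFormula.realize_rel₂, relMap_lt]

@[simp] theorem realize_leF {s t : treeLang.Term (α ⊕ Fin n)} :
    (leF s t).Realize v xs ↔ s.realize (Sum.elim v xs) ≤ t.realize (Sum.elim v xs) := by
  simp [leF, le_iff_lt_or_eq]

@[simp] theorem realize_meetT {s t : treeLang.Term α} :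
    (meetT s t).realize v = s.realize v ⊓ t.realize v := by
  simp [meetT, Term.realize_functions_apply₂, funMap_meet]

/-- The formula `a ∧ b ≤ c`. -/
def ternF (a b c : α) : treeLang.Formula α :=
  leF (n := 0) (meetT (Term.var (Sum.inl a)) (Term.var (Sum.inl b))) (Term.var (Sum.inl c))

@[simp] theorem realize_ternF {a b c : α} : (ternF a b c).Realize v ↔ Tern v a b c := by
  simp [ternF, Formula.Realize, Tern]

end Realize

end TreeStructures

/-! ### The theory of dense meet-trees -/

section DenseTrees

/-- The universal closure of a formula. -/
noncomputable def universalClosure {n : ℕ} (φ : treeLang.Formula (Fin n)) : treeLang.Sentence :=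
  Formula.iAlls (Fin n) (φ.relabel Sum.inr)

theorem realize_universalClosure {N : Type*} [treeLang.Structure N] {n : ℕ}
    {φ : treeLang.Formula (Fin n)} : N ⊨ universalClosure φ ↔ ∀ v : Fin n → N, φ.Realize v := by
  simp only [Sentence.Realize, universalClosure, Formula.realize_iAlls, Formula.realize_relabel]
  rfl

/-- There is an element between `x₀ < x₁`. -/
def betweenF : treeLang.Formula (Fin 2) :=
  ltF (n := 0) (Term.var (Sum.inl 0)) (Term.var (Sum.inl 1)) ⟹
    ∃' (ltF (n := 1) (Term.var (Sum.inl 0)) (&0) ⊓ ltF (n := 1) (&0) (Term.var (Sum.inl 1)))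

/-- There is an element below `x₀`. -/
def belowF : treeLang.Formula (Fin 1) :=
  ∃' (ltF (n := 1) (&0) (Term.var (Sum.inl 0)))

/-- There is an element above `x₀` in a different open cone than `x₁, …, xₙ`. -/
noncomputable def coneF (n : ℕ) : treeLang.Formula (Fin (n + 1)) :=
  ∃' (ltF (n := 1) (Term.var (Sum.inl 0)) (&0) ⊓ BoundedFormula.iInf fun i : Fin n =>
    ∼(ltF (n := 1) (Term.var (Sum.inl 0)) (meetT (&0) (Term.var (Sum.inl i.succ)))))

/-- The theory of dense meet-trees. -/
def denseTree : treeLang.Theory :=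
  meetTree ∪ ({universalClosure betweenF, universalClosure belowF} ∪
    Set.range fun n => universalClosure (coneF n))

variable {N : Type*} [SemilatticeInf N] [treeLang.Structure N] [IsTreeStructure N]

theorem realize_betweenF {v : Fin 2 → N} :
    betweenF.Realize v ↔ (v 0 < v 1 → ∃ c, v 0 < c ∧ c < v 1) := by
  simp [betweenF, Formula.Realize, Fin.snoc]

theorem realize_belowF {v : Fin 1 → N} : belowF.Realize v ↔ ∃ c, c < v 0 := by
  simp [belowF, Formula.Realize, Fin.snoc]

theorem realize_coneF {n : ℕ} {v : Fin (n + 1) → N} :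
    (coneF n).Realize v ↔ ∃ c, v 0 < c ∧ ∀ i : Fin n, ¬ v 0 < c ⊓ v i.succ := by
  simp only [coneF, Formula.Realize, BoundedFormula.realize_ex, BoundedFormula.realize_inf,
    realize_ltF, BoundedFormula.realize_iInf, BoundedFormula.realize_not, realize_meetT]
  simp [Fin.snoc]

theorem isDenseTree_iff : IsDenseTree N ↔ IsTree N ∧ (∀ v : Fin 2 → N, betweenF.Realize v) ∧
    (∀ v : Fin 1 → N, belowF.Realize v) ∧ ∀ n, ∀ v : Fin (n + 1) → N, (coneF n).Realize v := by
  simp only [realize_betweenF, realize_belowF, realize_coneF]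
  constructor
  · refine fun h => ⟨h.tree, fun v => h.dense _ _, fun v => h.exists_lt _, fun n v => ?_⟩
    classical
    obtain ⟨c, hc, hF⟩ := h.exists_cone (v 0) (Finset.univ.image fun i : Fin n => v i.succ)
    exact ⟨c, hc, fun i => hF _ (Finset.mem_image_of_mem _ (Finset.mem_univ i))⟩
  · rintro ⟨h₁, h₂, h₃, h₄⟩
    refine ⟨h₁, fun a b => h₂ ![a, b], fun a => h₃ ![a], fun a F => ?_⟩
    obtain ⟨c, hc, hF⟩ := h₄ F.card (Fin.cons a fun i => (F.equivFin.symm i : N))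
    refine ⟨c, hc, fun b hb => ?_⟩
    simpa using hF (F.equivFin ⟨b, hb⟩)

theorem model_denseTree_iff : N ⊨ denseTree ↔ IsDenseTree N := by
  rw [isDenseTree_iff, denseTree, Theory.model_union_iff, Theory.model_union_iff]
  simp only [Theory.model_iff, Set.mem_insert_iff, Set.mem_singleton_iff, forall_eq_or_imp,
    forall_eq, Set.forall_mem_range, realize_universalClosure, and_assoc]
  rw [← Theory.model_iff]
  exact and_congr_left fun _ => ⟨isTree_of_model, model_meetTree⟩

theorem model_meetTree_of_denseTree {N : Type*} [treeLang.Structure N] (h : N ⊨ denseTree) :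
    N ⊨ meetTree :=
  h.mono Set.subset_union_left

end DenseTrees

/-! ### Quantifier elimination -/

section QuantifierElimination

variable {N₁ N₂ : Type*} [SemilatticeInf N₁] [treeLang.Structure N₁] [IsTreeStructure N₁]
  [SemilatticeInf N₂] [treeLang.Structure N₂] [IsTreeStructure N₂]

theorem IsPartialIso.realize_term_mem {S : Set (N₁ × N₂)} (h : IsPartialIso S) {β : Type*}
    {v₁ : β → N₁} {v₂ : β → N₂} (hv : ∀ i, (v₁ i, v₂ i) ∈ S) (t : treeLang.Term β) :
    (t.realize v₁, t.realize v₂) ∈ S := by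
  induction t with
  | var i => exact hv i
  | @func l f ts ih =>
    obtain rfl : l = 2 := by cases f; rfl
    rw [Term.realize_func, Term.realize_func, funMap_meet, funMap_meet]
    exact h.inf_mem _ (ih 0) _ (ih 1)

theorem IsPartialIso.realize_iff [Nonempty N₁] [Nonempty N₂] (h₁ : IsDenseTree N₁)
    (h₂ : IsDenseTree N₂) {α : Type*} {n : ℕ} (φ : treeLang.BoundedFormula α n) :
    ∀ {S : Set (N₁ × N₂)}, IsPartialIso S → S.Finite →
    ∀ {v₁ : α → N₁} {v₂ : α → N₂} {xs₁ : Fin n → N₁} {xs₂ : Fin n → N₂},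
    (∀ i, (v₁ i, v₂ i) ∈ S) → (∀ i, (xs₁ i, xs₂ i) ∈ S) →
    (φ.Realize v₁ xs₁ ↔ φ.Realize v₂ xs₂) := by
  have hvars : ∀ {n : ℕ} {S : Set (N₁ × N₂)} {v₁ : α → N₁} {v₂ : α → N₂} {xs₁ : Fin n → N₁}
      {xs₂ : Fin n → N₂}, (∀ i, (v₁ i, v₂ i) ∈ S) → (∀ i, (xs₁ i, xs₂ i) ∈ S) →
      ∀ i, (Sum.elim v₁ xs₁ i, Sum.elim v₂ xs₂ i) ∈ S := by
    rintro n S v₁ v₂ xs₁ xs₂ hv hxs (i | i)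
    · exact hv i
    · exact hxs i
  induction φ with
  | falsum => exact fun _ _ _ _ _ _ _ _ => Iff.rfl
  | equal t₁ t₂ =>
    intro S hS _ v₁ v₂ xs₁ xs₂ hv hxs
    exact hS.eq_iff (hS.realize_term_mem (hvars hv hxs) t₁) (hS.realize_term_mem (hvars hv hxs) t₂)
  | @rel n l R ts =>
    intro S hS _ v₁ v₂ xs₁ xs₂ hv hxs
    obtain rfl : l = 2 := by cases R; rfl
    refine (relMap_lt R _).trans (Iff.trans ?_ (relMap_lt R _).symm)
    exact hS.lt_iff (hS.realize_term_mem (hvars hv hxs) (ts 0))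
      (hS.realize_term_mem (hvars hv hxs) (ts 1))
  | imp φ ψ ihφ ihψ =>
    intro S hS hf v₁ v₂ xs₁ xs₂ hv hxs
    exact imp_congr (ihφ hS hf hv hxs) (ihψ hS hf hv hxs)
  | @all n φ ih =>
    intro S hS hf v₁ v₂ xs₁ xs₂ hv hxs
    have hsnoc : ∀ {S' : Set (N₁ × N₂)} {c d}, S ⊆ S' → (c, d) ∈ S' →
        ∀ i, ((Fin.snoc xs₁ c : Fin (n + 1) → N₁) i, (Fin.snoc xs₂ d : Fin (n + 1) → N₂) i) ∈
          S' := by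
      intro S' c d hSS' hcd i
      refine Fin.lastCases ?_ (fun i => ?_) i
      · simpa using hcd
      · simpa using hSS' (hxs i)
    rw [BoundedFormula.realize_all, BoundedFormula.realize_all]
    constructor
    · intro H d
      obtain ⟨S', c, hS', hf', hSS', hcd⟩ := hS.swap.exists_extension
        (hf.preimage Prod.swap_injective.injOn) h₂.tree h₁ d
      have hsub : S ⊆ Prod.swap ⁻¹' S' := fun s hs => hSS' (show s.swap.swap ∈ S by simpa)
      exact (ih hS'.swap (hf'.preimage Prod.swap_injective.injOn) (fun i => hsub (hv i))
        (hsnoc hsub hcd)).1 (H c)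
    · intro H c
      obtain ⟨S', d, hS', hf', hSS', hcd⟩ := hS.exists_extension hf h₁.tree h₂ c
      exact (ih hS' hf' (fun i => hSS' (hv i)) (hsnoc hSS' hcd)).2 (H d)

/-- Quantifier elimination: in dense meet-trees, the type of a tuple is determined by the
relations `a ∧ b ≤ c` between its entries. -/
theorem realize_iff_of_tern [Nonempty N₁] [Nonempty N₂] (h₁ : IsDenseTree N₁)
    (h₂ : IsDenseTree N₂) {X : Type*} {e₁ : X → N₁} {e₂ : X → N₂}
    (h : ∀ a b c, Tern e₁ a b c ↔ Tern e₂ a b c) (φ : treeLang.Formula X) :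
    φ.Realize e₁ ↔ φ.Realize e₂ := by
  classical
  -- Only finitely many variables occur in `φ`; restricting to them makes the partial isomorphism
  -- finite.
  rw [Formula.Realize, Formula.Realize,
    ← BoundedFormula.realize_restrictFreeVar (f := id) (v := fun i => e₁ i) e₁ fun _ => rfl,
    ← BoundedFormula.realize_restrictFreeVar (f := id) (v := fun i => e₂ i) e₂ fun _ => rfl]
  refine (isPartialIso_of_tern (e₁ := fun i : φ.freeVarFinset => e₁ i) (e₂ := fun i => e₂ i)
    h₁.tree fun a b c => h a b c).realize_iff h₁ h₂ _ (Set.finite_range _)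
    (fun i => ⟨(i, i), ?_⟩) (fun i => i.elim0)
  simp

end QuantifierElimination

/-! ### An explicit dense meet-tree -/

section Branches

/-- A finitely supported labelling of the rationals below a given rational. -/
@[ext] structure Branch where
  height : ℚ
  label : ℚ →₀ ℕ
  label_eq_zero : ∀ t, height ≤ t → label t = 0

namespace Branch

instance : PartialOrder Branch where
  le a b := a.height ≤ b.height ∧ ∀ t < a.height, a.label t = b.label t
  le_refl a := ⟨le_rfl, fun _ _ => rfl⟩
  le_trans a b c hab hbc := ⟨hab.1.trans hbc.1, fun t ht =>
    (hab.2 t ht).trans (hbc.2 t (ht.trans_le hab.1))⟩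
  le_antisymm a b hab hba := by
    have h := le_antisymm hab.1 hba.1
    refine Branch.ext h (Finsupp.ext fun t => ?_)
    rcases lt_or_ge t a.height with ht | ht
    · exact hab.2 t ht
    · rw [a.label_eq_zero t ht, b.label_eq_zero t (h ▸ ht)]

/-- The restriction of a branch to the rationals below `r`. -/
noncomputable def trunc (a : Branch) (r : ℚ) : Branch where
  height := r
  label := a.label.filter (· < r)
  label_eq_zero _ ht := Finsupp.filter_apply_neg _ _ ht.not_gt

theorem trunc_label {a : Branch} {r t : ℚ} (ht : t < r) : (a.trunc r).label t = a.label t :=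
  Finsupp.filter_apply_pos (· < r) _ ht

theorem trunc_le {a : Branch} {r : ℚ} (hr : r ≤ a.height) : a.trunc r ≤ a :=
  ⟨hr, fun _ => trunc_label⟩

theorem le_trunc {a b : Branch} {r : ℚ} (hab : a ≤ b) (hr : a.height ≤ r) : a ≤ b.trunc r :=
  ⟨hr, fun t ht => (hab.2 t ht).trans (trunc_label (ht.trans_le hr)).symm⟩

/-- The height at which two branches split. -/
noncomputable def splitHeight (a b : Branch) : ℚ :=
  (insert (min a.height b.height) (a.label.neLocus b.label)).min' (Finset.insert_nonempty _ _)

theorem le_splitHeight {a b : Branch} {r : ℚ} : r ≤ splitHeight a b ↔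
    (r ≤ a.height ∧ r ≤ b.height) ∧ ∀ t < r, a.label t = b.label t := by
  simp only [splitHeight, Finset.le_min'_iff, Finset.forall_mem_insert, le_min_iff,
    Finsupp.mem_neLocus]
  exact and_congr_right fun _ => forall_congr' fun t => by
    rw [← not_imp_not, not_le, not_ne_iff]

noncomputable instance : SemilatticeInf Branch where
  inf a b := a.trunc (splitHeight a b)
  inf_le_left a b := trunc_le (le_splitHeight.1 le_rfl).1.1
  inf_le_right a b := by
    obtain ⟨h₁, h₂⟩ := le_splitHeight.1 (le_refl (splitHeight a b))
    exact ⟨h₁.2, fun t ht => (trunc_label ht).trans (h₂ t ht)⟩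
  le_inf a b c hab hac := le_trunc hab (le_splitHeight.2 ⟨⟨hab.1, hac.1⟩, fun t ht =>
    (hab.2 t ht).symm.trans (hac.2 t ht)⟩)

theorem isTree : IsTree Branch := by
  intro a b c hb hc
  rcases le_total b.height c.height with h | h
  · exact Or.inl ⟨h, fun t ht => (hb.2 t ht).trans (hc.2 t (ht.trans_le h)).symm⟩
  · exact Or.inr ⟨h, fun t ht => (hc.2 t ht).trans (hb.2 t (ht.trans_le h)).symm⟩

theorem height_lt {a b : Branch} (h : a < b) : a.height < b.height := by
  refine h.le.1.lt_of_not_ge fun h' => h.not_ge ⟨h', fun t ht => (h.le.2 t (ht.trans_le h')).symm⟩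

theorem isDenseTree : IsDenseTree Branch where
  tree := isTree
  dense a b hab := by
    obtain ⟨r, har, hrb⟩ := exists_between (height_lt hab)
    refine ⟨b.trunc r, (le_trunc hab.le har.le).lt_of_not_ge fun h => ?_,
      (trunc_le hrb.le).lt_of_not_ge fun h => ?_⟩
    · exact har.not_ge h.1
    · exact hrb.not_ge h.1
  exists_lt a := ⟨a.trunc (a.height - 1), (trunc_le (by linarith)).lt_of_not_ge fun h => by
    have : a.height ≤ a.height - 1 := h.1
    linarith⟩
  exists_cone a F := by
    classical
    -- The label at `a.height` names the open cone above `a`, so an unused label gives an unoccupied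
    -- cone.
    obtain ⟨n, hn⟩ := Infinite.exists_notMem_finset (F.image fun b => b.label a.height)
    let c : Branch :=
      { height := a.height + 1
        label := a.label + Finsupp.single a.height n
        label_eq_zero := fun t ht => by
          have h : a.height < t := by linarith
          simp [a.label_eq_zero t h.le, h.ne] }
    have hac : a ≤ c := ⟨by simp [c], fun t ht => by simp [c, ht.ne']⟩
    refine ⟨c, hac.lt_of_not_ge fun h => ?_, fun b hb hlt => hn ?_⟩
    · have : a.height + 1 ≤ a.height := h.1
      linarith
    · have h₁ := (inf_le_left : c ⊓ b ≤ c).2 _ (height_lt hlt)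
      have h₂ := (inf_le_right : c ⊓ b ≤ b).2 _ (height_lt hlt)
      refine Finset.mem_image.2 ⟨b, hb, ?_⟩
      rw [← h₂, h₁]
      simp [c, a.label_eq_zero]

instance : Nonempty Branch := ⟨⟨0, 0, fun _ _ => rfl⟩⟩

noncomputable instance : treeLang.Structure Branch where
  funMap f xs := match f with
    | TreeFunc.meet => xs 0 ⊓ xs 1
  RelMap R xs := match R with
    | TreeRel.lt => xs 0 < xs 1

instance : IsTreeStructure Branch := ⟨fun _ _ => Iff.rfl, fun _ _ => rfl⟩

end Branch

end Branches

/-! ### The model completion of the theory of meet-trees -/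

section ModelCompletion

/-! ### Embeddings of meet-trees as maps preserving and reflecting `a ∧ b ≤ c`. -/

section Embeddings

variable {K N : Type*} [SemilatticeInf K] [treeLang.Structure K] [IsTreeStructure K]
  [SemilatticeInf N] [treeLang.Structure N] [IsTreeStructure N]

theorem map_inf_of_embedding (f : K ↪[treeLang] N) (a b : K) : f (a ⊓ b) = f a ⊓ f b := by
  have := f.map_fun meetSymb ![a, b]
  rwa [funMap_meet, funMap_meet] at this

theorem lt_iff_of_embedding (f : K ↪[treeLang] N) {a b : K} : f a < f b ↔ a < b := by
  have := f.map_rel ltSymb ![a, b]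
  rwa [relMap_lt, relMap_lt] at this

theorem tern_embedding (f : K ↪[treeLang] N) {a b c : K} : Tern f a b c ↔ a ⊓ b ≤ c := by
  rw [Tern, ← map_inf_of_embedding, le_iff_lt_or_eq, le_iff_lt_or_eq, lt_iff_of_embedding,
    f.injective.eq_iff]

theorem nonempty_embedding_of_tern {e : K → N} (h : ∀ a b c, Tern e a b c ↔ a ⊓ b ≤ c) :
    Nonempty (K ↪[treeLang] N) := by
  have hle : ∀ {a b}, e a ≤ e b ↔ a ≤ b := fun {a b} => by simpa [Tern] using h a a b
  have hinf : ∀ a b, e (a ⊓ b) = e a ⊓ e b := fun a b =>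
    le_antisymm (le_inf (hle.2 inf_le_left) (hle.2 inf_le_right)) ((h a b _).2 le_rfl)
  refine ⟨⟨⟨e, fun a b hab => le_antisymm (hle.1 hab.le) (hle.1 hab.ge)⟩, ?_, ?_⟩⟩
  · intro n f xs
    obtain rfl : n = 2 := by cases f; rfl
    rw [funMap_meet, funMap_meet]
    exact hinf _ _
  · intro n R xs
    obtain rfl : n = 2 := by cases R; rfl
    rw [relMap_lt, relMap_lt]
    exact lt_iff_lt_of_le_iff_le' hle hle

end Embeddings

theorem exists_tern_finset {K N : Type*} [SemilatticeInf K] [SemilatticeInf N] [Nonempty N]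
    (hK : IsTree K) (hN : IsDenseTree N) (F : Finset K) :
    ∃ f : K → N, ∀ a ∈ F, ∀ b ∈ F, ∀ c ∈ F, Tern f a b c ↔ a ⊓ b ≤ c := by
  classical
  obtain ⟨S, hS, -, hF⟩ : ∃ S : Set (K × N), IsPartialIso S ∧ S.Finite ∧
      ∀ a ∈ F, ∃ d, (a, d) ∈ S := by
    induction F using Finset.induction with
    | empty => exact ⟨∅, isPartialIso_empty, Set.finite_empty, by simp⟩
    | insert a F _ ih =>
      obtain ⟨S, hS, hf, hF⟩ := ih
      obtain ⟨S', d, hS', hf', hsub, hd⟩ := hS.exists_extension hf hK hN a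
      refine ⟨S', hS', hf', fun b hb => ?_⟩
      rcases Finset.mem_insert.1 hb with rfl | hb
      · exact ⟨d, hd⟩
      · exact (hF b hb).imp fun _ h => hsub h
  choose! f hf using hF
  exact ⟨f, fun a ha b hb c hc =>
    (hS.le_iff _ (hS.inf_mem _ (hf a ha) _ (hf b hb)) _ (hf c hc)).symm⟩

/-- Each finite part of `K` maps faithfully into `Branch`. In an ultrapower indexed by the finite
subsets of `K`, along an ultrafilter containing all cones of larger subsets, these maps glue to an
embedding by Łoś's theorem. -/
theorem exists_embedding_denseTree (K : Type u) [treeLang.Structure K] (hK : K ⊨ meetTree) :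
    ∃ (N : Type u) (_ : treeLang.Structure N), N ⊨ denseTree ∧ Nonempty (K ↪[treeLang] N) := by
  obtain ⟨_, _, hT⟩ := exists_isTreeStructure hK
  choose f hf using exists_tern_finset (N := Branch) hT Branch.isDenseTree
  let U : Ultrafilter (Finset K) := Ultrafilter.of Filter.atTop
  have hN : (U : Filter (Finset K)).Product (fun _ => Branch) ⊨ denseTree := by
    refine ⟨fun φ hφ => (Ultraproduct.sentence_realize φ).2
      (Filter.Eventually.of_forall fun _ => ?_)⟩
    exact (model_denseTree_iff.2 Branch.isDenseTree).realize_of_mem φ hφ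
  refine ⟨_, inferInstance, hN, ?_⟩
  obtain ⟨_, _, -⟩ := exists_isTreeStructure (model_meetTree_of_denseTree hN)
  let e : K → (U : Filter (Finset K)).Product (fun _ => Branch) := fun a =>
    Quotient.mk (Filter.productSetoid _ _) fun F => f F a
  refine nonempty_embedding_of_tern (e := e) fun a b c => ?_
  refine (realize_ternF (v := e)).symm.trans
    ((Ultraproduct.realize_formula_cast (M := fun _ => Branch) (u := U) (ternF a b c)
      fun a F => f F a).trans ?_)
  simp only [realize_ternF]
  have hU : ∀ᶠ F in (U : Filter (Finset K)), Tern (f F) a b c ↔ a ⊓ b ≤ c := by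
    refine Filter.Eventually.filter_mono (Ultrafilter.of_le _) ?_
    classical
    filter_upwards [Filter.eventually_ge_atTop ({a, b, c} : Finset K)] with F hF
    exact hf F a (hF (by simp)) b (hF (by simp)) c (hF (by simp))
  rw [Filter.eventually_congr hU, Filter.eventually_const]

theorem isModelCompletion_denseTree : IsModelCompletion.{u} denseTree meetTree where
  extends_theory φ hφ := Theory.models_sentence_of_mem (Or.inl hφ)
  embeds K _ _ hK := exists_embedding_denseTree K hK
  complete K N₁ N₂ _ _ _ _ hK h₁ h₂ f₁ f₂ φ := by
    have : Nonempty N₁ := ‹Nonempty K›.map f₁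
    have : Nonempty N₂ := ‹Nonempty K›.map f₂
    obtain ⟨_, _, -⟩ := exists_isTreeStructure hK
    obtain ⟨_, _, -⟩ := exists_isTreeStructure (model_meetTree_of_denseTree h₁)
    obtain ⟨_, _, -⟩ := exists_isTreeStructure (model_meetTree_of_denseTree h₂)
    exact realize_iff_of_tern (model_denseTree_iff.1 h₁) (model_denseTree_iff.1 h₂)
      (fun a b c => (tern_embedding f₁).trans (tern_embedding f₂).symm) φ

/-- The models of any model completion of the theory of meet-trees are dense. -/
theorem IsModelCompletion.model_denseTree {T : treeLang.Theory}
    (hT : IsModelCompletion.{u} T meetTree) (N : Type u) [treeLang.Structure N] [Nonempty N]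
    [hN : N ⊨ T] : N ⊨ denseTree := by
  have hNtree : N ⊨ meetTree := ⟨fun φ hφ => (hT.extends_theory φ hφ).realize_sentence N⟩
  obtain ⟨N', _, hN', ⟨f⟩⟩ := exists_embedding_denseTree N hNtree
  have hN'tree := model_meetTree_of_denseTree hN'
  have : Nonempty N' := ‹Nonempty N›.map f
  obtain ⟨N'', _, hN'', ⟨g⟩⟩ := hT.embeds N'
  have : Nonempty N'' := ‹Nonempty N'›.map g
  have hN''tree : N'' ⊨ meetTree := ⟨fun φ hφ => (hT.extends_theory φ hφ).realize_sentence N''⟩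
  -- In the chain `N`, `N'`, `N''`, completeness over `N` makes the embedding of `N` into `N''`
  -- elementary. Witnesses for the density axioms exist in `N'` and survive in `N''`, so the axioms
  -- hold at points of `N`.
  have hcomp : ∀ {n : ℕ} (φ : treeLang.Formula (Fin n)) (v : Fin n → N),
      φ.Realize (fun i => g (f (v i))) → φ.Realize v := by
    intro n φ v h
    have := hT.complete N N N'' (Embedding.refl _ _) (g.comp f) (φ.relabel v)
    rw [Formula.realize_relabel, Formula.realize_relabel] at this
    exact this.2 h
  obtain ⟨_, _, htree⟩ := exists_isTreeStructure hNtree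
  obtain ⟨_, _, -⟩ := exists_isTreeStructure hN'tree
  obtain ⟨_, _, -⟩ := exists_isTreeStructure hN''tree
  rw [model_denseTree_iff, isDenseTree_iff] at hN' ⊢
  obtain ⟨-, hb, hl, hc⟩ := hN'
  refine ⟨htree, fun v => hcomp _ _ ?_, fun v => hcomp _ _ ?_, fun n v => hcomp _ _ ?_⟩
  · rw [realize_betweenF]
    intro h
    obtain ⟨c, h₁, h₂⟩ := realize_betweenF.1 (hb fun i => f (v i)) ((lt_iff_of_embedding g).1 h)
    exact ⟨g c, (lt_iff_of_embedding g).2 h₁, (lt_iff_of_embedding g).2 h₂⟩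
  · obtain ⟨c, h₁⟩ := realize_belowF.1 (hl fun i => f (v i))
    exact realize_belowF.2 ⟨g c, (lt_iff_of_embedding g).2 h₁⟩
  · obtain ⟨c, h₁, h₂⟩ := realize_coneF.1 (hc n fun i => f (v i))
    refine realize_coneF.2 ⟨g c, (lt_iff_of_embedding g).2 h₁, fun i => ?_⟩
    rw [← map_inf_of_embedding, lt_iff_of_embedding]
    exact h₂ i

end ModelCompletion

/-! ### Types over parameters -/

section TypesOverParameters

section General

variable {L : FirstOrder.Language.{v, w}} {C : Type u} [L.Structure C] {A : Set C} {α : Type x}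

theorem not_mem_formulas_iff {p : TypeOver L A α} {φ : L[[A]].Formula α} :
    ∼φ ∈ formulas p ↔ φ ∉ formulas p :=
  p.not_mem_iff (Formula.equivSentence φ)

theorem formulas_injective :
    Function.Injective (formulas : TypeOver L A α → Set (L[[A]].Formula α)) := by
  intro p q h
  refine SetLike.ext fun φ => ?_
  obtain ⟨ψ, rfl⟩ := Formula.equivSentence.surjective φ
  exact Set.ext_iff.1 h ψ

end General

variable {C : Type u} {A : Set C} {α : Type x}

/-- The formula `a ∧ b ≤ c` with parameters. -/
def ternA (a b c : A ⊕ α) : treeLang[[A]].Formula α :=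
  BoundedFormula.constantsVarsEquiv.symm (ternF a b c)

/-! ### Formulas with parameters in models of the theory with constants. -/

section Models

variable {N : Type*} [treeLang.Structure N] [treeLang[[A]].Structure N]
  [(treeLang.lhomWithConstants A).IsExpansionOn N]

theorem model_denseTree_of_completeTheory [treeLang.Structure C] (hC : C ⊨ denseTree)
    (hN : N ⊨ treeLang[[A]].completeTheory C) : N ⊨ denseTree := by
  refine ⟨fun φ hφ => ?_⟩
  rw [← LHom.realize_onSentence N (treeLang.lhomWithConstants A)]
  refine hN.realize_of_mem _ ?_
  rw [mem_completeTheory, LHom.realize_onSentence]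
  exact hC.realize_of_mem φ hφ

/-- The parameters together with a tuple. -/
def withParams (A : Set C) [treeLang[[A]].Structure N] (v : α → N) : A ⊕ α → N :=
  Sum.elim (fun a => ((treeLang.con a : treeLang[[A]].Constants) : N)) v

theorem withParams_comp {N : Type*} [treeLang[[A]].Structure N] {β : Type*} (v : α → N)
    (y : β → α) (a : A ⊕ β) : withParams A (v ∘ y) a = withParams A v (Sum.map id y a) := by
  cases a <;> rfl

theorem realize_ternA [SemilatticeInf N] [IsTreeStructure N] {v : α → N} {a b c : A ⊕ α} :
    (ternA a b c).Realize v ↔ Tern (withParams A v) a b c := by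
  rw [← realize_ternF, Formula.Realize, ← BoundedFormula.realize_constantsVarsEquiv, ternA,
    Equiv.apply_symm_apply]
  rfl

theorem realize_iff_of_tern_withParams [SemilatticeInf N] [IsTreeStructure N] [Nonempty N]
    (hN : IsDenseTree N) {N' : Type*} [treeLang.Structure N'] [treeLang[[A]].Structure N']
    [(treeLang.lhomWithConstants A).IsExpansionOn N'] [SemilatticeInf N'] [IsTreeStructure N']
    [Nonempty N'] (hN' : IsDenseTree N') {v : α → N} {v' : α → N'}
    (h : ∀ a b c, Tern (withParams A v) a b c ↔ Tern (withParams A v') a b c)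
    (φ : treeLang[[A]].Formula α) : φ.Realize v ↔ φ.Realize v' := by
  rw [Formula.Realize, Formula.Realize, ← BoundedFormula.realize_constantsVarsEquiv,
    ← BoundedFormula.realize_constantsVarsEquiv]
  exact realize_iff_of_tern hN hN' h _

end Models

variable [treeLang.Structure C]

/-- The relation `a ∧ b ≤ c` between the parameters and the variables of a type. -/
def typeRel (p : TypeOver treeLang A α) (a b c : A ⊕ α) : Prop := ternA a b c ∈ formulas p

/-- A realization of a type over parameters in a meet-tree. -/
structure Realization (p : TypeOver treeLang A α) where
  N : Type (max u x)
  [order : SemilatticeInf N]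
  [treeStructure : treeLang.Structure N]
  [paramStructure : treeLang[[A]].Structure N]
  [isExpansion : (treeLang.lhomWithConstants A).IsExpansionOn N]
  [isTreeStructure : IsTreeStructure N]
  [nonempty : Nonempty N]
  isDense : IsDenseTree N
  model : N ⊨ treeLang[[A]].completeTheory C
  val : α → N
  mem_iff : ∀ φ, φ ∈ formulas p ↔ φ.Realize val

attribute [instance] Realization.order Realization.treeStructure Realization.paramStructure
  Realization.isExpansion Realization.isTreeStructure Realization.nonempty

theorem exists_realization (hC : C ⊨ denseTree) (p : TypeOver treeLang A α) :
    Nonempty (Realization p) := by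
  obtain ⟨N, v, hv⟩ := Theory.exists_modelType_is_realized_in _ p
  let _ : treeLang.Structure N := (treeLang.lhomWithConstants A).reduct N
  have : (treeLang.lhomWithConstants A).IsExpansionOn N := LHom.isExpansionOn_reduct _ _
  have hN : (N : Type _) ⊨ denseTree := model_denseTree_of_completeTheory hC N.is_model
  obtain ⟨_, _, -⟩ := exists_isTreeStructure (model_meetTree_of_denseTree hN)
  refine ⟨{
    N := N
    isDense := model_denseTree_iff.1 hN
    model := N.is_model
    val := v
    mem_iff := fun φ => ?_ }⟩
  rw [← Theory.CompleteType.formula_mem_typeOf (T := treeLang[[A]].completeTheory C), hv]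
  rfl

variable {p q : TypeOver treeLang A α}

theorem Realization.typeRel_iff (r : Realization p) {a b c : A ⊕ α} :
    typeRel p a b c ↔ Tern (withParams A r.val) a b c := by
  rw [typeRel, r.mem_iff, realize_ternA]

theorem isMeetRel_typeRel (hC : C ⊨ denseTree) (p : TypeOver treeLang A α) :
    IsMeetRel (typeRel p) := by
  obtain ⟨r⟩ := exists_realization hC p
  have : typeRel p = Tern (withParams A r.val) := by
    funext a b c
    exact propext r.typeRel_iff
  rw [this]
  exact isMeetRel_tern r.isDense.tree _

theorem eq_of_typeRel (hC : C ⊨ denseTree)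
    (h : ∀ a b c, typeRel p a b c ↔ typeRel q a b c) : p = q := by
  obtain ⟨r⟩ := exists_realization hC p
  obtain ⟨s⟩ := exists_realization hC q
  refine formulas_injective (Set.ext fun φ => ?_)
  rw [r.mem_iff, s.mem_iff]
  exact realize_iff_of_tern_withParams r.isDense s.isDense
    (fun a b c => by rw [← r.typeRel_iff, ← s.typeRel_iff, h]) φ

/-- The relation `a ∧ b ≤ c` is inherited by types with more variables. -/
theorem typeRel_map (hC : C ⊨ denseTree) {β : Type*} {r : TypeOver treeLang A β} {y : α → β}
    (h : ∀ φ ∈ formulas p, φ.relabel y ∈ formulas r) (a b c : A ⊕ α) :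
    typeRel r (Sum.map id y a) (Sum.map id y b) (Sum.map id y c) ↔ typeRel p a b c := by
  obtain ⟨s⟩ := exists_realization hC r
  have hs : ∀ φ ∈ formulas p, φ.Realize (s.val ∘ y) := fun φ hφ => by
    rw [← Formula.realize_relabel, ← s.mem_iff]
    exact h φ hφ
  rw [s.typeRel_iff, Tern, ← withParams_comp, ← withParams_comp, ← withParams_comp]
  refine (realize_ternA (A := A) (v := s.val ∘ y)).symm.trans ⟨fun h' => ?_, hs _⟩
  by_contra hn
  exact hs _ (not_mem_formulas_iff.2 hn) h'

end TypesOverParameters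

/-! ### Types are determined by pairs of variables -/

section Pairs

variable {C : Type u} [treeLang.Structure C] {A : Set C} {α : Type x}
  {p : TypeOver treeLang A α}

section

variable {N : Type*} [SemilatticeInf N] [treeLang.Structure N] [treeLang[[A]].Structure N]
  [(treeLang.lhomWithConstants A).IsExpansionOn N] [IsTreeStructure N] {v : α → N}

theorem tern_withParams_of_restrictVars (r : Realization p) {β : Type} {y : β → α}
    (h : ∀ φ ∈ restrictVars p y, φ.Realize v) (a b c : A ⊕ β) :
    Tern (withParams A v) (Sum.map id y a) (Sum.map id y b) (Sum.map id y c) ↔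
      typeRel p (Sum.map id y a) (Sum.map id y b) (Sum.map id y c) := by
  have hψ : ∀ ψ : treeLang[[A]].Formula β, ψ.Realize (r.val ∘ y) → ψ.Realize (v ∘ y) :=
    fun ψ hψ => by
      rw [← Formula.realize_relabel] at hψ ⊢
      exact h _ ⟨(r.mem_iff _).2 hψ, ψ, rfl⟩
  rw [r.typeRel_iff]
  simp only [Tern, ← withParams_comp]
  refine (realize_ternA (A := A) (v := v ∘ y)).symm.trans
    (Iff.trans ?_ (realize_ternA (A := A) (v := r.val ∘ y)))
  exact ⟨fun h' => not_not.1 fun hn => hψ (∼(ternA a b c)) hn h', hψ _⟩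

theorem tern_withParams_of_restrictEmpty (r : Realization p)
    (h : ∀ φ ∈ restrictEmpty p, φ.Realize v) (i j k : α) :
    Tern (withParams A v) (Sum.inr i) (Sum.inr j) (Sum.inr k) ↔
      typeRel p (Sum.inr i) (Sum.inr j) (Sum.inr k) := by
  have hψ : ∀ ψ : treeLang.Formula α, ψ.Realize r.val → ψ.Realize v := fun ψ hψ => by
    rw [← LHom.realize_onFormula (treeLang.lhomWithConstants A)] at hψ ⊢
    exact h _ ⟨(r.mem_iff _).2 hψ, ψ, rfl⟩
  rw [r.typeRel_iff]
  refine (realize_ternF (v := v)).symm.trans (Iff.trans ?_ (realize_ternF (v := r.val)))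
  exact ⟨fun h' => not_not.1 fun hn => hψ (∼(ternF i j k)) hn h', hψ _⟩

theorem tern_withParams_inl [SemilatticeInf C] [IsTreeStructure C]
    (hN : N ⊨ treeLang[[A]].completeTheory C) (a b c : A) :
    Tern (withParams A v) (Sum.inl a) (Sum.inl b) (Sum.inl c) ↔ (a : C) ⊓ b ≤ c := by
  have h := realize_iff_of_model_completeTheory C N
    (ternA (α := Empty) (Sum.inl a) (Sum.inl b) (Sum.inl c))
  have hN := realize_ternA (A := A) (v := (default : Empty → N)) (a := Sum.inl a) (b := Sum.inl b)
    (c := Sum.inl c)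
  have hC := realize_ternA (A := A) (v := (default : Empty → C)) (a := Sum.inl a) (b := Sum.inl b)
    (c := Sum.inl c)
  exact hN.symm.trans (h.trans hC)

end

/-- By quantifier elimination only atoms `a ∧ b ≤ c` matter. One with three variables has no
parameters, one with one or two variables is seen by a pair, and one with none is decided by the
complete theory. -/
theorem entails_of_pairs [Nonempty C] (hC : C ⊨ denseTree) {n : ℕ}
    (p : TypeOver treeLang A (Fin n)) {φ : treeLang[[A]].Formula (Fin n)} (hφ : φ ∈ formulas p) :
    Entails ((⋃ (i : Fin n) (j : Fin n), restrictVars p ![i, j]) ∪ restrictEmpty p) φ := by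
  obtain ⟨r⟩ := exists_realization hC p
  refine Theory.models_sentence_iff.2 fun N => ?_
  let _ : treeLang[[A]].Structure N := (treeLang[[A]].lhomWithConstants (Fin n)).reduct N
  have : (treeLang[[A]].lhomWithConstants (Fin n)).IsExpansionOn N := LHom.isExpansionOn_reduct _ _
  let _ : treeLang.Structure N := (treeLang.lhomWithConstants A).reduct N
  have : (treeLang.lhomWithConstants A).IsExpansionOn N := LHom.isExpansionOn_reduct _ _
  have hNC : (N : Type _) ⊨ treeLang[[A]].completeTheory C :=
    (LHom.onTheory_model (treeLang[[A]].lhomWithConstants (Fin n)) _).1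
      (N.is_model.mono Set.subset_union_left)
  have hN := model_denseTree_of_completeTheory hC hNC
  obtain ⟨_, _, -⟩ := exists_isTreeStructure (model_meetTree_of_denseTree hN)
  obtain ⟨_, _, -⟩ := exists_isTreeStructure (model_meetTree_of_denseTree hC)
  rw [Formula.realize_equivSentence]
  set v : Fin n → N := fun i => (((treeLang[[A]]).con i : treeLang[[A]][[Fin n]].Constants) : N)
  have hv : ∀ ψ ∈ (⋃ (i : Fin n) (j : Fin n), restrictVars p ![i, j]) ∪ restrictEmpty p,
      ψ.Realize v := fun ψ hψ => by
    rw [← Formula.realize_equivSentence N]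
    exact N.is_model.realize_of_mem _ (Or.inr ⟨ψ, hψ, rfl⟩)
  refine (realize_iff_of_tern_withParams (model_denseTree_iff.1 hN) r.isDense ?_ φ).2
    ((r.mem_iff φ).1 hφ)
  intro a b c
  rw [← r.typeRel_iff]
  have hpair := fun i j => tern_withParams_of_restrictVars (v := v) r (y := ![i, j])
    fun ψ hψ => hv ψ (Or.inl (Set.mem_iUnion₂.2 ⟨i, j, hψ⟩))
  rcases a with a | i <;> rcases b with b | j <;> rcases c with c | k
  · rw [r.typeRel_iff, tern_withParams_inl hNC, tern_withParams_inl r.model]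
  · exact hpair k k (Sum.inl a) (Sum.inl b) (Sum.inr 0)
  · exact hpair j j (Sum.inl a) (Sum.inr 0) (Sum.inl c)
  · exact hpair j k (Sum.inl a) (Sum.inr 0) (Sum.inr 1)
  · exact hpair i i (Sum.inr 0) (Sum.inl b) (Sum.inl c)
  · exact hpair i k (Sum.inr 0) (Sum.inl b) (Sum.inr 1)
  · exact hpair i j (Sum.inr 0) (Sum.inr 1) (Sum.inl c)
  · exact tern_withParams_of_restrictEmpty r (fun ψ hψ => hv ψ (Or.inr hψ)) i j k

/-- Two types in one variable have at most `2 ^ 5` joint types. -/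
theorem encard_jointTypes_le (hC : C ⊨ denseTree) (p q : TypeOver treeLang A (Fin 1)) :
    (jointTypes p q).encard ≤ (2 ^ 5 : ℕ) := by
  have hcard : (Set.univ : Set (Fin 5 → Prop)).encard = (2 ^ 5 : ℕ) := by
    rw [Set.encard_univ, ENat.card_eq_coe_fintype_card]
    simp
  rw [← hcard]
  refine Set.encard_le_encard_of_injOn (f := fun r => pairInvariant (typeRel r)
    (Set.range Sum.inl) (Sum.inr 0) (Sum.inr 1)) (Set.mapsTo_univ _ _) ?_
  intro r hr s hs hrs
  have hag : ∀ (p : TypeOver treeLang A (Fin 1)) (y : Fin 1 → Fin 2),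
      (∀ φ ∈ formulas p, φ.relabel y ∈ formulas r) →
      (∀ φ ∈ formulas p, φ.relabel y ∈ formulas s) →
      AgreeOn (typeRel r) (typeRel s) (insert (Sum.inr (y 0)) (Set.range Sum.inl)) := by
    intro p y hr hs
    have hsub : insert (Sum.inr (y 0)) (Set.range Sum.inl) ⊆
        Set.range (Sum.map id y : A ⊕ Fin 1 → A ⊕ Fin 2) := by
      rintro _ (rfl | ⟨a, rfl⟩)
      · exact ⟨Sum.inr 0, rfl⟩
      · exact ⟨Sum.inl a, rfl⟩
    refine AgreeOn.mono ?_ hsub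
    rintro _ ⟨a, rfl⟩ _ ⟨b, rfl⟩ _ ⟨c, rfl⟩
    rw [typeRel_map hC hr, typeRel_map hC hs]
  have h := (isMeetRel_typeRel hC r).agreeOn_pair (isMeetRel_typeRel hC s)
    (hag p ![0] hr.1 hs.1) (hag q ![1] hr.2 hs.2) hrs
  have huniv : ∀ a : A ⊕ Fin 2,
      a ∈ insert (Sum.inr 0) (insert (Sum.inr 1) (Set.range (Sum.inl : A → A ⊕ Fin 2))) := by
    rintro (a | i)
    · simp
    · fin_cases i <;> simp
  exact eq_of_typeRel hC fun a b c => h a (huniv a) b (huniv b) c (huniv c)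

end Pairs

/-! ### Coheirs as ultrafilters -/

section Ultrafilters

/-- Finite satisfiability in `A` is the finite intersection property for the solution sets within
`A`. The ultrafilter decides every formula, so it yields a full ternary relation even where `q` is
silent. -/
theorem exists_ultrafilter_of_mem_uf {L : FirstOrder.Language.{v, w}} {C : Type u} [L.Structure C]
    {n : ℕ} {A : Set C} {Δ : PartitionedFormulas L n} {p : TypeOver L A (Fin n)}
    {q : Set (L[[C]].Formula (Fin n))} (hq : q ∈ uf Δ p) :
    ∃ U : Ultrafilter (Fin n → C), (∀ᶠ a : Fin n → C in U, ∀ i, a i ∈ A) ∧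
      (∀ θ ∈ q, ∀ᶠ a : Fin n → C in U, θ.Realize a) ∧
      ∀ θ ∈ formulas p, ∀ᶠ a : Fin n → C in U, θ.Realize a := by
  let B : Set (L[[C]].Formula (Fin n)) → Set (L[[A]].Formula (Fin n)) → Set (Fin n → C) :=
    fun q₀ p₀ => {a | (∀ i, a i ∈ A) ∧ (∀ θ ∈ q₀, θ.Realize a) ∧ ∀ θ ∈ p₀, θ.Realize a}
  obtain ⟨U, hU⟩ := Ultrafilter.exists_ultrafilter_of_finite_inter_nonempty
    {s | ∃ q₀ ⊆ q, q₀.Finite ∧ ∃ p₀ ⊆ formulas p, p₀.Finite ∧ B q₀ p₀ = s} <| by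
    intro T hT
    have hT' : ∀ s ∈ T, ∃ q₀, q₀ ⊆ q ∧ q₀.Finite ∧
        ∃ p₀, p₀ ⊆ formulas p ∧ p₀.Finite ∧ B q₀ p₀ = s :=
      fun s hs => hT hs
    choose! Q hQ hQf P hP hPf hB using hT'
    obtain ⟨a, ha⟩ := hq.2 (⋃ s ∈ T, Q s) (Set.iUnion₂_subset hQ)
      (T.finite_toSet.biUnion hQf) (⋃ s ∈ T, P s)
      (Set.iUnion₂_subset hP) (T.finite_toSet.biUnion hPf)
    refine ⟨a, fun s hs => ?_⟩
    rw [← hB s hs]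
    exact ⟨ha.1, fun θ hθ => ha.2.1 θ (Set.mem_iUnion₂.2 ⟨s, hs, hθ⟩),
      fun θ hθ => ha.2.2 θ (Set.mem_iUnion₂.2 ⟨s, hs, hθ⟩)⟩
  have hmem : ∀ q₀ ⊆ q, q₀.Finite → ∀ p₀ ⊆ formulas p, p₀.Finite →
      ∀ᶠ a : Fin n → C in U, a ∈ B q₀ p₀ :=
    fun q₀ hq₀ hq₀f p₀ hp₀ hp₀f => hU ⟨q₀, hq₀, hq₀f, p₀, hp₀, hp₀f, rfl⟩
  refine ⟨U, ?_, fun θ hθ => ?_, fun θ hθ => ?_⟩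
  · exact (hmem ∅ (Set.empty_subset _) Set.finite_empty ∅ (Set.empty_subset _)
      Set.finite_empty).mono fun a ha => ha.1
  · exact (hmem {θ} (Set.singleton_subset_iff.2 hθ) (Set.finite_singleton θ) ∅
      (Set.empty_subset _) Set.finite_empty).mono fun a ha => ha.2.1 θ rfl
  · exact (hmem ∅ (Set.empty_subset _) Set.finite_empty {θ} (Set.singleton_subset_iff.2 hθ)
      (Set.finite_singleton θ)).mono fun a ha => ha.2.2 θ rfl

/-- A complete `Δ`-type is determined by any ultrafilter that contains it. -/
theorem mem_deltaType_iff {L : FirstOrder.Language.{v, w}} {C : Type u} [L.Structure C]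
    {n : ℕ} {Δ : PartitionedFormulas L n} {q : Set (L[[C]].Formula (Fin n))}
    (hq : q ∈ deltaTypes C Δ) {U : Ultrafilter (Fin n → C)}
    (hU : ∀ θ ∈ q, ∀ᶠ a : Fin n → C in U, θ.Realize a) (θ : L[[C]].Formula (Fin n)) :
    θ ∈ q ↔ θ ∈ deltaFormulas Δ ∧ ∀ᶠ a : Fin n → C in U, θ.Realize a := by
  refine ⟨fun h => ⟨hq.1 h, hU θ h⟩, ?_⟩
  rintro ⟨⟨φ, hφ, c, rfl | rfl⟩, hθ⟩
  · refine (hq.2.2 φ hφ c).resolve_right fun h => ?_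
    obtain ⟨a, h₁, h₂⟩ := (hθ.and (hU _ h)).exists
    exact h₂ h₁
  · refine (hq.2.2 φ hφ c).resolve_left fun h => ?_
    obtain ⟨a, h₁, h₂⟩ := (hθ.and (hU _ h)).exists
    exact h₁ h₂

/-! ### The limit of the ternary relation along an ultrafilter. -/

variable {C : Type u} [SemilatticeInf C] {n : ℕ}

/-- The relation `a ∧ b ≤ c` between the elements of `C` and a generic tuple. -/
def limitRel (U : Ultrafilter (Fin n → C)) (x y z : C ⊕ Fin n) : Prop :=
  ∀ᶠ a : Fin n → C in U, Tern (Sum.elim id a) x y z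

variable {U U' : Ultrafilter (Fin n → C)}

theorem isMeetRel_limitRel (hC : IsTree C) (U : Ultrafilter (Fin n → C)) :
    IsMeetRel (limitRel U) where
  left _ _ := Filter.Eventually.of_forall fun a => (isMeetRel_tern hC (Sum.elim id a)).left _ _
  symm h := h.mono fun a h => (isMeetRel_tern hC (Sum.elim id a)).symm h
  trans h₁ h₂ h₃ := by
    filter_upwards [h₁, h₂, h₃] with a h₁ h₂ h₃
    exact (isMeetRel_tern hC (Sum.elim id a)).trans h₁ h₂ h₃
  comp _ _ _ := Ultrafilter.eventually_or.1 <|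
    Filter.Eventually.of_forall fun a => (isMeetRel_tern hC (Sum.elim id a)).comp _ _ _

theorem eventually_limitRel_iff {F : Set (C ⊕ Fin n)} (hF : F.Finite) :
    ∀ᶠ a : Fin n → C in U, ∀ x ∈ F, ∀ y ∈ F, ∀ z ∈ F,
      limitRel U x y z ↔ Tern (Sum.elim id a) x y z := by
  simp only [Filter.eventually_all_finite hF]
  intro x _ y _ z _
  by_cases h : limitRel U x y z
  · filter_upwards [h] with a ha
    exact iff_of_true h ha
  · filter_upwards [Ultrafilter.eventually_not.2 h] with a ha
    exact iff_of_false h ha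

/-- The position over `C` of the `i`-th entry of a generic tuple. -/
def limitPosition (U : Ultrafilter (Fin n → C)) (i : Fin n) : Position C where
  D c := limitRel U (Sum.inl c) (Sum.inl c) (Sum.inr i)
  E c c' := limitRel U (Sum.inr i) (Sum.inl c) (Sum.inl c')
  G c := limitRel U (Sum.inr i) (Sum.inr i) (Sum.inl c)

theorem isCoheir_limitPosition {A : Set C} (hU : ∀ᶠ a : Fin n → C in U, ∀ i, a i ∈ A) (i : Fin n) :
    (limitPosition U i).IsCoheir A := by
  intro F hF
  obtain ⟨a, haA, ha⟩ := (hU.and (eventually_limitRel_iff (U := U)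
    ((hF.image Sum.inl).insert (Sum.inr i)))).exists
  have hl : ∀ c ∈ F, Sum.inl c ∈ insert (Sum.inr i) (Sum.inl '' F : Set (C ⊕ Fin n)) :=
    fun c hc => Or.inr ⟨c, hc, rfl⟩
  have hr : Sum.inr i ∈ insert (Sum.inr i) (Sum.inl '' F : Set (C ⊕ Fin n)) := Or.inl rfl
  refine ⟨a i, haA i, fun c hc => ?_, fun c hc c' hc' => ?_, fun c hc => ?_⟩
  · refine (ha _ (hl c hc) _ (hl c hc) _ hr).trans ?_
    simp [Tern]
  · exact ha _ hr _ (hl c hc) _ (hl c' hc')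
  · refine (ha _ hr _ hr _ (hl c hc)).trans ?_
    simp [Tern]

theorem limitRel_inl {a b c : C} :
    limitRel U (Sum.inl a) (Sum.inl b) (Sum.inl c) ↔ a ⊓ b ≤ c := by
  simp [limitRel, Tern]

/-- What a coheir leaves open over its restriction. -/
def limitInvariant (A : Set C) (U : Ultrafilter (Fin n → C)) :
    (Fin n → Fin 3 → Prop) × (Fin n → Fin n → Fin 5 → Prop) :=
  (fun i => (limitPosition U i).invariant A,
    fun i j => pairInvariant (limitRel U) (Set.range Sum.inl) (Sum.inr i) (Sum.inr j))

theorem agreeOn_limitRel_point (hC : IsTree C) {A : Set C} (hA : ∀ a ∈ A, ∀ b ∈ A, a ⊓ b ∈ A)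
    (hU : ∀ᶠ a : Fin n → C in U, ∀ i, a i ∈ A) (hU' : ∀ᶠ a : Fin n → C in U', ∀ i, a i ∈ A)
    (h : AgreeOn (limitRel U) (limitRel U') (Set.range (Sum.map ((↑) : A → C) id)))
    (i : Fin n) (hinv : (limitPosition U i).invariant A = (limitPosition U' i).invariant A) :
    AgreeOn (limitRel U) (limitRel U') (insert (Sum.inr i) (Set.range Sum.inl)) := by
  have hl : ∀ c ∈ A, Sum.inl c ∈ Set.range (Sum.map ((↑) : A → C) (id : Fin n → Fin n)) :=
    fun c hc => ⟨Sum.inl ⟨c, hc⟩, rfl⟩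
  have hr : Sum.inr i ∈ Set.range (Sum.map ((↑) : A → C) (id : Fin n → Fin n)) := ⟨Sum.inr i, rfl⟩
  obtain ⟨hD, hE, hG⟩ := (isCoheir_limitPosition hU i).eq hC hA (isCoheir_limitPosition hU' i)
    ⟨fun c hc => h _ (hl c hc) _ (hl c hc) _ hr,
      fun c hc c' hc' => h _ hr _ (hl c hc) _ (hl c' hc'),
      fun c hc => h _ hr _ hr _ (hl c hc)⟩ hinv
  have hm := isMeetRel_limitRel hC U
  have hm' := isMeetRel_limitRel hC U'
  -- As `C` is closed under meets, this case reduces to the lower set of the position.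
  have hinf : ∀ (U : Ultrafilter (Fin n → C)) (c c' : C),
      limitRel U (Sum.inl c) (Sum.inl c') (Sum.inr i) ↔ (limitPosition U i).D (c ⊓ c') := by
    intro U c c'
    simp [limitPosition, limitRel, Tern]
  rintro _ (rfl | ⟨a, rfl⟩) _ (rfl | ⟨b, rfl⟩) _ (rfl | ⟨c, rfl⟩)
  · exact iff_of_true (hm.left _ _) (hm'.left _ _)
  · exact hG c
  · exact iff_of_true (hm.left _ _) (hm'.left _ _)
  · exact hE b c
  · exact iff_of_true (hm.right _ _) (hm'.right _ _)
  · rw [hm.symm_iff, hm'.symm_iff]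
    exact hE a c
  · rw [hinf, hinf, hD]
  · rw [limitRel_inl, limitRel_inl]

theorem limitRel_iff_of_invariant (hC : IsTree C) {A : Set C} (hA : ∀ a ∈ A, ∀ b ∈ A, a ⊓ b ∈ A)
    (hU : ∀ᶠ a : Fin n → C in U, ∀ i, a i ∈ A) (hU' : ∀ᶠ a : Fin n → C in U', ∀ i, a i ∈ A)
    (h : AgreeOn (limitRel U) (limitRel U') (Set.range (Sum.map ((↑) : A → C) id)))
    (hinv : limitInvariant A U = limitInvariant A U') (x y z : C ⊕ Fin n) :
    limitRel U x y z ↔ limitRel U' x y z := by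
  have hpoint : ∀ i, AgreeOn (limitRel U) (limitRel U')
      (insert (Sum.inr i) (Set.range Sum.inl)) := fun i =>
    agreeOn_limitRel_point hC hA hU hU' h i (congrFun (congrArg Prod.fst hinv) i)
  have hpair : ∀ i j, AgreeOn (limitRel U) (limitRel U')
      (insert (Sum.inr i) (insert (Sum.inr j) (Set.range Sum.inl))) := fun i j =>
    (isMeetRel_limitRel hC U).agreeOn_pair (isMeetRel_limitRel hC U') (hpoint i) (hpoint j)
      (congrFun (congrFun (congrArg Prod.snd hinv) i) j)
  have hl : ∀ c (i j : Fin n), Sum.inl c ∈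
      insert (Sum.inr i) (insert (Sum.inr j) (Set.range (Sum.inl : C → C ⊕ Fin n))) :=
    fun c i j => by simp
  have hi : ∀ i j : Fin n, Sum.inr i ∈
      insert (Sum.inr i) (insert (Sum.inr j) (Set.range (Sum.inl : C → C ⊕ Fin n))) :=
    fun i j => by simp
  have hj : ∀ i j : Fin n, Sum.inr j ∈
      insert (Sum.inr i) (insert (Sum.inr j) (Set.range (Sum.inl : C → C ⊕ Fin n))) :=
    fun i j => by simp
  rcases x with a | i <;> rcases y with b | j <;> rcases z with c | k
  · rw [limitRel_inl, limitRel_inl]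
  · exact hpair k k _ (hl a k k) _ (hl b k k) _ (hi k k)
  · exact hpair j j _ (hl a j j) _ (hi j j) _ (hl c j j)
  · exact hpair j k _ (hl a j k) _ (hi j k) _ (hj j k)
  · exact hpair i i _ (hi i i) _ (hl b i i) _ (hl c i i)
  · exact hpair i k _ (hi i k) _ (hl b i k) _ (hj i k)
  · exact hpair i j _ (hi i j) _ (hj i j) _ (hl c i j)
  · exact h _ ⟨Sum.inr i, rfl⟩ _ ⟨Sum.inr j, rfl⟩ _ ⟨Sum.inr k, rfl⟩

variable [treeLang.Structure C] [IsTreeStructure C]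

theorem limitRel_map_iff {A : Set C} {p : TypeOver treeLang A (Fin n)}
    (hU : ∀ θ ∈ formulas p, ∀ᶠ a : Fin n → C in U, θ.Realize a) (x y z : A ⊕ Fin n) :
    limitRel U (Sum.map (↑) id x) (Sum.map (↑) id y) (Sum.map (↑) id z) ↔ typeRel p x y z := by
  have hmap : ∀ (a : Fin n → C) (x : A ⊕ Fin n),
      Sum.elim id a (Sum.map (↑) id x) = withParams A a x := by
    rintro a (x | i) <;> rfl
  have hre : limitRel U (Sum.map (↑) id x) (Sum.map (↑) id y) (Sum.map (↑) id z) ↔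
      ∀ᶠ a : Fin n → C in U, (ternA x y z).Realize a := by
    refine Filter.eventually_congr (Filter.Eventually.of_forall fun a => ?_)
    rw [realize_ternA, Tern, Tern, hmap, hmap, hmap]
  rw [hre]
  refine ⟨fun h => ?_, hU _⟩
  by_contra hn
  obtain ⟨a, h₁, h₂⟩ := (h.and (hU _ (not_mem_formulas_iff.2 hn))).exists
  exact h₂ h₁

/-- A formula involves finitely many points, so almost every tuple realizes the limit relation on
them. Tuples typical for `U` and `U'` then have the same ternary relations, and quantifier
elimination inside `C` applies. -/
theorem eventually_inst_of_limitRel [Nonempty C] (hC : IsDenseTree C)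
    (h : ∀ x y z, limitRel U x y z ↔ limitRel U' x y z) {m : ℕ}
    (φ : treeLang.Formula (Fin n ⊕ Fin m)) (c : Fin m → C)
    (hφ : ∀ᶠ a : Fin n → C in U, (inst φ c).Realize a) :
    ∀ᶠ a : Fin n → C in U', (inst φ c).Realize a := by
  by_contra hn
  let s : Fin n ⊕ Fin m → C ⊕ Fin n := Sum.elim Sum.inr (Sum.inl ∘ c)
  have hF : (Set.range s).Finite := Set.finite_range s
  obtain ⟨a, ha, haF⟩ := (hφ.and (eventually_limitRel_iff (U := U) hF)).exists
  obtain ⟨a', ha', haF'⟩ := ((Ultrafilter.eventually_not.2 hn).and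
    (eventually_limitRel_iff (U := U') hF)).exists
  have hs : ∀ (a : Fin n → C) (x : Fin n ⊕ Fin m), Sum.elim id a (s x) = Sum.elim a c x := by
    rintro a (i | j) <;> rfl
  rw [realize_inst] at ha ha'
  refine ha' ((realize_iff_of_tern hC hC (fun x y z => ?_) φ).1 ha)
  have h₁ := haF _ ⟨x, rfl⟩ _ ⟨y, rfl⟩ _ ⟨z, rfl⟩
  have h₂ := haF' _ ⟨x, rfl⟩ _ ⟨y, rfl⟩ _ ⟨z, rfl⟩
  rw [Tern, hs, hs, hs] at h₁ h₂
  rw [Tern, Tern, ← h₁, ← h₂, h]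

end Ultrafilters

/-! ### Dense meet-trees have small directionality -/

theorem finite_uf {C : Type u} [treeLang.Structure C] [Nonempty C] (hC : C ⊨ denseTree)
    (M : treeLang.ElementarySubstructure C) {n : ℕ} (p : TypeOver treeLang (M : Set C) (Fin n))
    (Δ : PartitionedFormulas treeLang n) : (uf Δ p).Finite := by
  obtain ⟨_, _, hT⟩ := exists_isTreeStructure (model_meetTree_of_denseTree hC)
  have hCd := model_denseTree_iff.1 hC
  have hM : ∀ a ∈ (M : Set C), ∀ b ∈ (M : Set C), a ⊓ b ∈ (M : Set C) := fun a ha b hb => by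
    rw [← meet_eq]
    refine M.toSubstructure.fun_mem meetSymb ![a, b] fun i => ?_
    fin_cases i
    · exact ha
    · exact hb
  choose U hUM hUq hUp using fun q : uf Δ p => exists_ultrafilter_of_mem_uf q.2
  -- The invariants range over a finite set; with `p` they determine the limit relation, hence the
  -- `Δ`-type.
  have hinj : Function.Injective fun q : uf Δ p => limitInvariant (M : Set C) (U q) := by
    intro q q' hqq
    have hag : AgreeOn (limitRel (U q)) (limitRel (U q'))
        (Set.range (Sum.map (Subtype.val : ↥(M : Set C) → C) id)) := by
      rintro _ ⟨x, rfl⟩ _ ⟨y, rfl⟩ _ ⟨z, rfl⟩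
      rw [limitRel_map_iff (hUp q), limitRel_map_iff (hUp q')]
    have hrel := limitRel_iff_of_invariant hT hM (hUM q) (hUM q') hag hqq
    have hinst : ∀ {m : ℕ} (φ : treeLang.Formula (Fin n ⊕ Fin m)) (c : Fin m → C),
        (∀ᶠ a : Fin n → C in U q, (inst φ c).Realize a) ↔
          ∀ᶠ a : Fin n → C in U q', (inst φ c).Realize a :=
      fun φ c => ⟨eventually_inst_of_limitRel hCd hrel φ c,
        eventually_inst_of_limitRel hCd (fun x y z => (hrel x y z).symm) φ c⟩
    refine Subtype.ext (Set.ext fun θ => ?_)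
    rw [mem_deltaType_iff q.2.1 (hUq q), mem_deltaType_iff q'.2.1 (hUq q')]
    refine and_congr_right ?_
    rintro ⟨φ, -, c, rfl | rfl⟩
    · exact hinst φ.2 c
    · simp only [Formula.realize_not, Ultrafilter.eventually_not]
      exact not_congr (hinst φ.2 c)
  exact Set.finite_coe_iff.1 (Finite.of_injective _ hinj)

end Directionality

open Directionality
theorem mainTheorem12 :
    (∃ T : treeLang.Theory, IsModelCompletion.{u} T meetTree) ∧
    ∀ T : treeLang.Theory, IsModelCompletion.{u} T meetTree →
      SmallDirectionality.{u} T ∧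
      (∀ (C : Type u) [treeLang.Structure C] [Nonempty C] [C ⊨ T]
        (M : treeLang.ElementarySubstructure C) (n : ℕ)
        (p : TypeOver treeLang (M : Set C) (Fin n)),
        ∀ φ ∈ formulas p,
          Entails ((⋃ (i : Fin n) (j : Fin n), restrictVars p ![i, j]) ∪ restrictEmpty p) φ) ∧
      (∃ K : ℕ, ∀ (C : Type u) [treeLang.Structure C] [Nonempty C] [C ⊨ T] (A : Set C)
        (p q : TypeOver treeLang A (Fin 1)), (jointTypes p q).encard ≤ K) := by
  refine ⟨⟨denseTree, isModelCompletion_denseTree⟩, fun T hT => ⟨?_, ?_, 2 ^ 5, ?_⟩⟩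
  · intro C _ _ _ M n p Δ _
    exact finite_uf (hT.model_denseTree C) M p Δ
  · intro C _ _ _ M n p φ hφ
    exact entails_of_pairs (hT.model_denseTree C) p hφ
  · intro C _ _ _ A p q
    exact encard_jointTypes_le (hT.model_denseTree C) p q
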